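/- Let $\mathcal B$ be a complex manifold and $E\to\mathcal B$ a holomorphic line bundle with a smooth Hermitian metric. Let $\rho:SE\to\mathcal B$ be its circle bundle (the unit vectors of $E$), $\mathfrak a_t(p)=e^{it}p$ the circle action on $SE$, and $\mathcal T$ its infinitesimal generator. For $m\in\mathbb Z$ let $E^m$ be the $m$-th tensor power of $E$ ($E^0$ is trivial, and $E^m=(E^*)^{\otimes|m|}$ for $m<0$). For $p\in SE$ let $\wp_m(p)=p\otimes\dots\otimes p\in E^m$ if $m\ge 0$ (with $\wp_0(p)=1$), and $\wp_m(p)=p^*\otimes\dots\otimes p^*$ if $m<0$, where $p^*$ is the dual element, $p^*(p)=1$. Let $\theta$ be the connection form on $SE$ of the Hermitian holomorphic connection of $E$: if $p=f\sigma$ with $\sigma$ a local holomorphic frame of $E$, then $i\theta=df/f+\rho^*\partial\log|\sigma|^2$ on $SE$. Let $\overline{\mathcal V}=\{v\in\mathbb C T SE:\rho_*v\in T^{0,1}\mathcal B\}$, let $\overline{\mathbb D}$ be the operator of the associated complex on sections of $\Lambda^q\overline{\mathcal V}^*$ (the restriction to $\overline{\mathcal V}$ of the exterior derivative), and let $\beta=-i\theta|_{\overline{\mathcal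 V}}$. The kernel $\overline{\mathcal K}=\overline{\mathcal V}\cap\ker\theta$ of $\beta$ is a CR structure on $SE$. Let $\Lambda^q\overline{\mathcal K}^*$ be the bundle of the elements of $\Lambda^q\overline{\mathcal V}^*$ that are annihilated by interior multiplication by $\mathcal T$; restriction identifies it with the $q$-th exterior power of the dual of $\overline{\mathcal K}$. The $\overline\partial_b$ operators are $$\overline\partial_b\phi=\overline{\mathbb D}\phi-i\beta\wedge\mathcal L_{\mathcal T}\phi .$$ Let $$C^\infty_m(SE;\Lambda^q\overline{\mathcal K}^*)=\{\phi\in C^\infty(SE;\Lambda^q\overline{\mathcal K}^*):\mathcal L_{\mathcal T}\phi+im\phi=0\},$$ and for an $E^m$-valued $(0,q)$-form $\eta$ on $\mathcal B$ let $$F_m(\eta)(p)=\rho_p^*\langle\wp_{-m}(p),\eta(\rho(p))\rangle,\qquad p\in SE.$$ Then for every $m\in\mathbb Z$: (1) for every $q\ge0$, $F_m$ is a linear isomorphism of $C^\infty(\mathcal B;\Lambda^{0,q}\mathcal B\otimes E^m)$ onto $C^\infty_m(SE;\Lambda^q\overline{\mathcal K}^*)$; (2) the operators $\overline\partial$ make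 the spaces $C^\infty(\mathcal B;\Lambda^{0,q}\mathcal B\otimes E^m)$, $q\ge0$, into a complex, and $\overline\partial_b$ maps $C^\infty_m(SE;\Lambda^q\overline{\mathcal K}^*)$ to $C^\infty_m(SE;\Lambda^{q+1}\overline{\mathcal K}^*)$ with $\overline\partial_b^2=0$, so that there is a complex $$\cdots\to C^\infty_m(SE;\Lambda^q\overline{\mathcal K}^*)\xrightarrow{\ \overline\partial_b\ }C^\infty_m(SE;\Lambda^{q+1}\overline{\mathcal K}^*)\to\cdots;$$ (3) $\overline\partial_bF_m=F_m\overline\partial$ on $C^\infty(\mathcal B;\Lambda^{0,q}\mathcal B\otimes E^m)$ for every $q\ge0$; (4) hence, for every $q\ge 0$, $F_m$ induces an isomorphism of the $\overline\partial$ cohomology group of $E^m$ in degree $(0,q)$ onto the cohomology group of the complex in (2) in degree $q$. -/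

import Mathlib

open scoped Manifold ContDiff Topology TensorProduct
open Bundle Set

set_option linter.unusedSectionVars false

noncomputable section
namespace CircleBundleCR

/-! ### Alternating forms -/
section Algebra
variable {U W : Type*} [NormedAddCommGroup U] [NormedSpace ℝ U]
  [NormedAddCommGroup W] [NormedSpace ℝ W]

/-- The multilinear map underlying `complexPullbackForm`. -/
def complexPullbackMulti {k : ℕ} (α : W [⋀^Fin k]→L[ℝ] ℂ) (A B : U →L[ℝ] W) :
    ContinuousMultilinearMap ℝ (fun _ : Fin k => U) ℂ :=
  ∑ S : Finset (Fin k), (Complex.I ^ S.card) •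
    α.toContinuousMultilinearMap.compContinuousLinearMap (fun j => if j ∈ S then B else A)

theorem complexPullbackMulti_apply {k : ℕ} (α : W [⋀^Fin k]→L[ℝ] ℂ) (A B : U →L[ℝ] W)
    (v : Fin k → U) :
    complexPullbackMulti α A B v =
      ∑ S : Finset (Fin k), Complex.I ^ S.card * α (fun j => if j ∈ S then B (v j) else A (v j)) := by
  simp only [complexPullbackMulti, _root_.sum_apply,
    _root_.smul_apply, smul_eq_mul,
    ContinuousMultilinearMap.compContinuousLinearMap_apply]
  refine Finset.sum_congr rfl fun S _ => ?_
  congr 1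
  change α _ = α _
  congr 1
  funext j
  split_ifs <;> rfl

/-- If `α_ℂ` is the `ℂ`-multilinear extension of `α` to the complexification `W ⊕ iW`, then
`complexPullbackForm α A B (v₁, …, v_k) = α_ℂ(A v₁ + i B v₁, …, A v_k + i B v_k)`, as
`complexPullbackForm_apply` spells out. -/
def complexPullbackForm {k : ℕ} (α : W [⋀^Fin k]→L[ℝ] ℂ) (A B : U →L[ℝ] W) : U [⋀^Fin k]→L[ℝ] ℂ :=
  { complexPullbackMulti α A B with
    map_eq_zero_of_eq' := by
      intro v i j hv hij
      change complexPullbackMulti α A B v = 0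
      rw [complexPullbackMulti_apply]
      refine Finset.sum_involution (fun S _ => S.map (Equiv.swap i j).toEmbedding) ?_ ?_ ?_ ?_
      · intro S _
        have hsw : (fun l => if l ∈ S.map (Equiv.swap i j).toEmbedding then B (v l) else A (v l)) =
            (fun l => if l ∈ S then B (v l) else A (v l)) ∘ Equiv.swap i j := by
          funext l
          have hvl : v (Equiv.swap i j l) = v l := by
            by_cases h1 : l = i
            · subst h1; simp [hv]
            by_cases h2 : l = j
            · subst h2; simp [hv]
            rw [Equiv.swap_apply_of_ne_of_ne h1 h2]
          simp [Finset.mem_map_equiv, hvl]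
        rw [hsw, Finset.card_map]
        have := α.toAlternatingMap.map_swap (fun l => if l ∈ S then B (v l) else A (v l)) hij
        simp only [ContinuousAlternatingMap.coe_toAlternatingMap] at this
        rw [this]; ring
      · intro S _ hne heq
        apply hne
        have hmem : i ∈ S ↔ j ∈ S := by
          have : i ∈ S.map (Equiv.swap i j).toEmbedding ↔ j ∈ S := by
            simp [Finset.mem_map_equiv]
          rw [← this, heq]
        rw [α.map_eq_zero_of_eq _ _ hij, mul_zero]
        simp [hmem, hv]
      · intros; simp
      · intro S _
        ext l; simp [Finset.mem_map_equiv] }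

theorem complexPullbackForm_apply {k : ℕ} (α : W [⋀^Fin k]→L[ℝ] ℂ) (A B : U →L[ℝ] W)
    (v : Fin k → U) :
    complexPullbackForm α A B v =
      ∑ S : Finset (Fin k), Complex.I ^ S.card * α (fun j => if j ∈ S then B (v j) else A (v j)) :=
  complexPullbackMulti_apply α A B v

/-- `complexPullbackForm` as a `ℂ`-linear map. -/
def complexPullback (k : ℕ) (A B : U →L[ℝ] W) :
    (W [⋀^Fin k]→L[ℝ] ℂ) →ₗ[ℂ] (U [⋀^Fin k]→L[ℝ] ℂ) where
  toFun α := complexPullbackForm α A B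
  map_add' α α' := by
    ext v
    simp [complexPullbackForm_apply, mul_add, Finset.sum_add_distrib]
  map_smul' c α := by
    ext v
    simp [complexPullbackForm_apply, Finset.mul_sum, mul_left_comm]

/-- The exterior product `φ ↦ β ∧ φ` with a `1`-form,
`(β ∧ φ)(v₀, …, v_k) = ∑ (-1)^j β(v_j) φ(v₀, …, v̂_j, …, v_k)`. -/
def wedgeOne (k : ℕ) (β : W →L[ℝ] ℂ) :
    (W [⋀^Fin k]→L[ℝ] ℂ) →ₗ[ℂ] (W [⋀^Fin (k + 1)]→L[ℝ] ℂ) where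
  toFun φ := ContinuousAlternatingMap.alternatizeUncurryFin (β.smulRight φ)
  map_add' φ φ' := by
    ext v
    simp [ContinuousAlternatingMap.alternatizeUncurryFin_apply, Finset.sum_add_distrib]
  map_smul' c φ := by
    ext v
    simp [ContinuousAlternatingMap.alternatizeUncurryFin_apply, Finset.mul_sum, mul_left_comm]

end Algebra

section ZeroType
variable (V : Type*) [NormedAddCommGroup V] [NormedSpace ℂ V]
/-- Complex-valued alternating forms of type `(0,q)` on a complex vector space: `ℝ`-multilinear
forms that are conjugate-linear in each variable, so that their `ℂ`-multilinear extensions vanish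
if one argument is of type `(1,0)`. -/
def FormZeroQ (q : ℕ) : Submodule ℂ (V [⋀^Fin q]→L[ℝ] ℂ) where
  carrier := {α | ∀ (v : Fin q → V) (j : Fin q),
    α (Function.update v j (Complex.I • v j)) = -Complex.I * α v}
  add_mem' := by
    intro a b ha hb v j
    simp only [ContinuousAlternatingMap.add_apply, ha v j, hb v j]; ring
  zero_mem' := by intro v j; simp
  smul_mem' := by
    intro c a ha v j
    simp only [ContinuousAlternatingMap.smul_apply, smul_eq_mul, ha v j]; ring

/-- Multiplication by `i`. -/
def mulI : V →L[ℝ] V := (Complex.I • ContinuousLinearMap.id ℂ V).restrictScalars ℝ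

/-- The projection on the component of type `(0,k)`,
`v ↦ α_ℂ((v₁ + iJv₁)/2, …, (v_k + iJv_k)/2)`. -/
def projZeroQ (k : ℕ) : (V [⋀^Fin k]→L[ℝ] ℂ) →ₗ[ℂ] FormZeroQ V k :=
  (complexPullback k ((1/2 : ℝ) • ContinuousLinearMap.id ℝ V) ((1/2 : ℝ) • mulI V)).codRestrict _ <| by
    intro α v j
    change complexPullbackForm α _ _ _ = -Complex.I * complexPullbackForm α _ _ _
    rw [complexPullbackForm_apply, complexPullbackForm_apply, Finset.mul_sum]
    refine Finset.sum_equiv ⟨fun S => symmDiff S {j}, fun S => symmDiff S {j}, fun S => by simp, fun S => by simp⟩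
      (by simp) ?_
    intro S _
    simp only [Equiv.coe_fn_mk]
    have hne : ∀ l, l ≠ j → (l ∈ symmDiff S {j} ↔ l ∈ S) := by
      intro l hl; simp [Finset.mem_symmDiff, hl]
    by_cases hj : j ∈ S
    · have hj' : j ∉ symmDiff S {j} := by simp [Finset.mem_symmDiff, hj]
      have hcard : S.card = (symmDiff S {j}).card + 1 := by
        have : S = insert j (symmDiff S {j}) := by
          ext l
          by_cases hl : l = j
          · subst hl; simp [hj]
          · simp [hne l hl, hl]
        rw [← Finset.card_insert_of_notMem hj', ← this]
      set g : Fin k → V := fun l => if l ∈ symmDiff S {j} then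
        ((1/2 : ℝ) • mulI V) (v l) else ((1/2 : ℝ) • ContinuousLinearMap.id ℝ V) (v l) with hg
      have hf : (fun l => if l ∈ S then
          ((1/2 : ℝ) • mulI V) (Function.update v j (Complex.I • v j) l)
          else ((1/2 : ℝ) • ContinuousLinearMap.id ℝ V) (Function.update v j (Complex.I • v j) l))
          = Function.update g j ((-1 : ℝ) • g j) := by
        funext l
        by_cases hl : l = j
        · subst hl
          simp [hg, hj, hj', mulI, smul_smul]
        · simp [hg, hl, hne l hl]
      rw [hf, α.map_update_smul, Function.update_eq_self, hcard, pow_succ]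
      simp; ring
    · have hj' : j ∈ symmDiff S {j} := by simp [Finset.mem_symmDiff, hj]
      have hcard : (symmDiff S {j}).card = S.card + 1 := by
        have : symmDiff S {j} = insert j S := by
          ext l
          by_cases hl : l = j
          · subst hl; simp [hj']
          · simp [hne l hl, hl]
        rw [this, Finset.card_insert_of_notMem hj]
      have hf : (fun l => if l ∈ S then
          ((1/2 : ℝ) • mulI V) (Function.update v j (Complex.I • v j) l)
          else ((1/2 : ℝ) • ContinuousLinearMap.id ℝ V) (Function.update v j (Complex.I • v j) l))
          = fun l => if l ∈ symmDiff S {j} then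
        ((1/2 : ℝ) • mulI V) (v l) else ((1/2 : ℝ) • ContinuousLinearMap.id ℝ V) (v l) := by
        funext l
        by_cases hl : l = j
        · subst hl
          simp [hj, hj', mulI]
        · simp [hl, hne l hl]
      rw [hf, hcard, pow_succ, ← mul_assoc, mul_comm (-Complex.I), mul_assoc (Complex.I ^ _)]
      simp
end ZeroType
section CircleBundle
variable (V : Type*) [NormedAddCommGroup V] [NormedSpace ℂ V]
  {B : Type*} [TopologicalSpace B] [ChartedSpace V B]
  (E : B → Type*) [∀ x, NormedAddCommGroup (E x)] [∀ x, InnerProductSpace ℂ (E x)]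
  [TopologicalSpace (TotalSpace ℂ E)] [FiberBundle ℂ E] [VectorBundle ℂ ℂ E]

/-- The local holomorphic frame of `E` given by the preferred trivialization at `x₀`; it is used
only over the base set of that trivialization. -/
def localFrame (x₀ x : B) : E x := (trivializationAt ℂ E x₀).symm x 1

/-- The Hermitian metric of the line bundle `E`, given by the inner products of the fibres, is
`C^∞`: the functions `|σ|²` are smooth for local holomorphic frames `σ`. -/
class SmoothHermitian : Prop where
  contMDiffOn_normSq : ∀ x₀ : B, ContMDiffOn 𝓘(ℝ, V) 𝓘(ℝ, ℝ) ∞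
    (fun x => ‖localFrame E x₀ x‖ ^ 2) (trivializationAt ℂ E x₀).baseSet

/-- The circle bundle `SE`, that is, the set of the unit vectors of `E`. -/
abbrev CircleBundle : Type _ := {p : TotalSpace ℂ E // ‖p.2‖ = 1}

variable {E}

/-- The projection `ρ : SE → B`. -/
def rho (p : CircleBundle E) : B := p.1.1

/-- A point of `SE` as a vector in a fibre of `E`. -/
def vec (p : CircleBundle E) : E (rho p) := p.1.2

/-- The coefficient `f` in `p = f σ`, with `σ` the local holomorphic frame at `x₀`. -/
def fiberCoord (x₀ : B) (p : CircleBundle E) : ℂ := (trivializationAt ℂ E x₀ p.1).2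

/-- The unit vector `v / |v|` if `v ≠ 0`. -/
def normalize (p₀ : CircleBundle E) (x : B) (v : E x) : CircleBundle E :=
  open Classical in
  if h : v = 0 then p₀ else ⟨⟨x, ((‖v‖⁻¹ : ℝ) : ℂ) • v⟩, by
    simp [norm_smul, h]⟩

theorem symm_eq_smul {x₀ x : B} (hx : x ∈ (trivializationAt ℂ E x₀).baseSet) (z : ℂ) :
    (trivializationAt ℂ E x₀).symm x z = z • localFrame E x₀ x := by
  have := (Trivialization.symmₗ ℂ (trivializationAt ℂ E x₀) x).map_smul z 1
  rw [smul_eq_mul, mul_one, Trivialization.coe_symmₗ _ hx] at this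
  exact this

theorem localFrame_ne_zero {x₀ x : B} (hx : x ∈ (trivializationAt ℂ E x₀).baseSet) :
    localFrame E x₀ x ≠ 0 := by
  intro h
  have h1 := (trivializationAt ℂ E x₀).apply_mk_symm hx (1 : ℂ)
  have h2 := (trivializationAt ℂ E x₀).apply_mk_symm hx (0 : ℂ)
  have h3 : (trivializationAt ℂ E x₀).symm x (0 : ℂ) = 0 := by
    rw [symm_eq_smul hx, zero_smul]
  rw [← localFrame, h] at h1
  rw [h3, h1] at h2
  simp at h2

theorem vec_eq {x₀ : B} (p : CircleBundle E) (hx : rho p ∈ (trivializationAt ℂ E x₀).baseSet) :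
    vec p = fiberCoord x₀ p • localFrame E x₀ (rho p) := by
  rw [← symm_eq_smul hx]
  exact ((trivializationAt ℂ E x₀).symm_apply_apply_mk hx (vec p)).symm

theorem fiberCoord_ne_zero {x₀ : B} (p : CircleBundle E)
    (hx : rho p ∈ (trivializationAt ℂ E x₀).baseSet) : fiberCoord x₀ p ≠ 0 := by
  intro h
  have h1 := vec_eq p hx
  rw [h, zero_smul] at h1
  have h2 : ‖vec p‖ = 1 := p.2
  simp [h1] at h2

theorem mem_base (p : CircleBundle E) : rho p ∈ (trivializationAt ℂ E (rho p)).baseSet :=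
  mem_baseSet_trivializationAt ℂ E (rho p)

theorem continuous_rho : Continuous (rho : CircleBundle E → B) :=
  (FiberBundle.continuous_proj ℂ E).comp continuous_subtype_val

theorem continuousOn_fiberCoord (x₀ : B) :
    ContinuousOn (fiberCoord x₀ : CircleBundle E → ℂ)
      (rho ⁻¹' (trivializationAt ℂ E x₀).baseSet) := by
  have h := (trivializationAt ℂ E x₀).continuousOn
  have h2 := h.comp (f := (Subtype.val : CircleBundle E → TotalSpace ℂ E))
    (s := rho ⁻¹' (trivializationAt ℂ E x₀).baseSet) continuous_subtype_val.continuousOn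
    (by intro p hp; exact (trivializationAt ℂ E x₀).mem_source.2 hp)
  exact continuous_snd.comp_continuousOn h2

/-- The inverse of the chart `circleChart`: `(y, t) ↦ e^{it} γ(x)`, where `y` is the coordinate of
`x`, and `γ` is the unitary frame of `E` that is a multiple, by positive functions, of the
constant multiple of the holomorphic frame at `ρ(p₀)` that passes through `p₀`. -/
def circleInv (p₀ : CircleBundle E) (w : V × ℝ) : CircleBundle E :=
  normalize p₀ ((chartAt V (rho p₀)).symm w.1)
    ((fiberCoord (rho p₀) p₀ * Complex.exp (w.2 * Complex.I)) •
      localFrame E (rho p₀) ((chartAt V (rho p₀)).symm w.1))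

variable {V} in
theorem continuousOn_norm_frame [SmoothHermitian V E] (x₀ : B) :
    ContinuousOn (fun x => ‖localFrame E x₀ x‖) (trivializationAt ℂ E x₀).baseSet := by
  have := (SmoothHermitian.contMDiffOn_normSq (V := V) (E := E) x₀).continuousOn.sqrt
  refine this.congr fun x _ => ?_
  simp [Real.sqrt_sq (norm_nonneg _)]

variable {V}

theorem circleInv_val (p₀ : CircleBundle E) {w : V × ℝ}
    (hw : (chartAt V (rho p₀)).symm w.1 ∈ (trivializationAt ℂ E (rho p₀)).baseSet) :
    (circleInv V p₀ w).1 = (trivializationAt ℂ E (rho p₀)).toOpenPartialHomeomorph.symm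
      ((chartAt V (rho p₀)).symm w.1,
        ((‖fiberCoord (rho p₀) p₀‖ * ‖localFrame E (rho p₀) ((chartAt V (rho p₀)).symm w.1)‖)⁻¹ : ℝ) *
          (fiberCoord (rho p₀) p₀ * Complex.exp (w.2 * Complex.I))) := by
  have h0 := localFrame_ne_zero hw
  have h1 := fiberCoord_ne_zero p₀ (mem_base p₀)
  have h2 : (fiberCoord (rho p₀) p₀ * Complex.exp (w.2 * Complex.I)) •
      localFrame E (rho p₀) ((chartAt V (rho p₀)).symm w.1) ≠ 0 :=
    smul_ne_zero (mul_ne_zero h1 (Complex.exp_ne_zero _)) h0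
  refine (congrArg Subtype.val (dif_neg h2)).trans ?_
  refine Eq.trans ?_ ((trivializationAt ℂ E (rho p₀)).mk_symm hw _)
  refine congrArg (TotalSpace.mk _) ?_
  rw [symm_eq_smul hw]
  have hn : ‖(fiberCoord (rho p₀) p₀ * Complex.exp (w.2 * Complex.I)) •
      localFrame E (rho p₀) ((chartAt V (rho p₀)).symm w.1)‖ =
      ‖fiberCoord (rho p₀) p₀‖ * ‖localFrame E (rho p₀) ((chartAt V (rho p₀)).symm w.1)‖ := by
    rw [norm_smul, norm_mul, Complex.norm_exp_ofReal_mul_I, mul_one]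
  rw [hn, smul_smul]

theorem rho_circleInv (p₀ : CircleBundle E) {w : V × ℝ}
    (hw : (chartAt V (rho p₀)).symm w.1 ∈ (trivializationAt ℂ E (rho p₀)).baseSet) :
    rho (circleInv V p₀ w) = (chartAt V (rho p₀)).symm w.1 := by
  rw [rho, circleInv_val p₀ hw]
  exact (trivializationAt ℂ E (rho p₀)).proj_symm_apply' hw

theorem fiberCoord_circleInv (p₀ : CircleBundle E) {w : V × ℝ}
    (hw : (chartAt V (rho p₀)).symm w.1 ∈ (trivializationAt ℂ E (rho p₀)).baseSet) :
    fiberCoord (rho p₀) (circleInv V p₀ w) =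
      ((‖fiberCoord (rho p₀) p₀‖ * ‖localFrame E (rho p₀) ((chartAt V (rho p₀)).symm w.1)‖)⁻¹ : ℝ) *
          (fiberCoord (rho p₀) p₀ * Complex.exp (w.2 * Complex.I)) := by
  rw [fiberCoord, circleInv_val p₀ hw]
  have := (trivializationAt ℂ E (rho p₀)).apply_symm_apply' (x := (((‖fiberCoord (rho p₀) p₀‖ * ‖localFrame E (rho p₀) ((chartAt V (rho p₀)).symm w.1)‖)⁻¹ : ℝ) *
          (fiberCoord (rho p₀) p₀ * Complex.exp (w.2 * Complex.I)) : ℂ)) hw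
  exact congrArg Prod.snd this

theorem eq_of_coords {x₀ : B} {p p' : CircleBundle E}
    (hx : rho p ∈ (trivializationAt ℂ E x₀).baseSet) (h : rho p = rho p')
    (hf : fiberCoord x₀ p = fiberCoord x₀ p') : p = p' := by
  apply Subtype.ext
  have hx' : rho p' ∈ (trivializationAt ℂ E x₀).baseSet := h ▸ hx
  apply (trivializationAt ℂ E x₀).injOn ((trivializationAt ℂ E x₀).mem_source.2 hx)
    ((trivializationAt ℂ E x₀).mem_source.2 hx')
  refine Prod.ext ?_ hf
  exact ((trivializationAt ℂ E x₀).coe_fst' hx).trans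
    (h.trans ((trivializationAt ℂ E x₀).coe_fst' hx').symm)

theorem norm_fiberCoord {x₀ : B} (p : CircleBundle E)
    (hx : rho p ∈ (trivializationAt ℂ E x₀).baseSet) :
    ‖fiberCoord x₀ p‖ = ‖localFrame E x₀ (rho p)‖⁻¹ := by
  have h2 : ‖vec p‖ = 1 := p.2
  rw [vec_eq p hx, norm_smul] at h2
  exact eq_inv_of_mul_eq_one_left h2

theorem ratio_circleInv (p₀ : CircleBundle E) {w : V × ℝ}
    (hw : (chartAt V (rho p₀)).symm w.1 ∈ (trivializationAt ℂ E (rho p₀)).baseSet) :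
    fiberCoord (rho p₀) (circleInv V p₀ w) / fiberCoord (rho p₀) p₀ =
      ((‖fiberCoord (rho p₀) p₀‖⁻¹ *
        ‖localFrame E (rho p₀) ((chartAt V (rho p₀)).symm w.1)‖⁻¹ : ℝ) : ℂ) *
          Complex.exp (w.2 * Complex.I) := by
  rw [fiberCoord_circleInv p₀ hw, mul_inv]
  field_simp [fiberCoord_ne_zero p₀ (mem_base p₀)]

theorem ratio_pos (p₀ : CircleBundle E) {w : V × ℝ}
    (hw : (chartAt V (rho p₀)).symm w.1 ∈ (trivializationAt ℂ E (rho p₀)).baseSet) :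
    0 < ‖fiberCoord (rho p₀) p₀‖⁻¹ *
        ‖localFrame E (rho p₀) ((chartAt V (rho p₀)).symm w.1)‖⁻¹ :=
  mul_pos (inv_pos.2 (norm_pos_iff.2 (fiberCoord_ne_zero p₀ (mem_base p₀))))
    (inv_pos.2 (norm_pos_iff.2 (localFrame_ne_zero hw)))

variable (V) in
/-- The chart `e^{it} γ(x) ↦ (y(x), t)`, `-π < t < π`, of `SE` around `p₀`, with `y` the preferred
holomorphic chart of `B` at `ρ(p₀)` and `γ` a unitary frame with `γ(ρ(p₀)) = p₀`. -/
def circleChart [SmoothHermitian V E] (p₀ : CircleBundle E) :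
    OpenPartialHomeomorph (CircleBundle E) (V × ℝ) where
  toFun p := (chartAt V (rho p₀) (rho p),
    Complex.arg (fiberCoord (rho p₀) p / fiberCoord (rho p₀) p₀))
  invFun w := circleInv V p₀ w
  source := {p | rho p ∈ (chartAt V (rho p₀)).source ∧
    rho p ∈ (trivializationAt ℂ E (rho p₀)).baseSet ∧
    fiberCoord (rho p₀) p / fiberCoord (rho p₀) p₀ ∈ Complex.slitPlane}
  target := {w | w.1 ∈ (chartAt V (rho p₀)).target ∧
    (chartAt V (rho p₀)).symm w.1 ∈ (trivializationAt ℂ E (rho p₀)).baseSet ∧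
    w.2 ∈ Ioo (-Real.pi) Real.pi}
  map_source' := by
    rintro p ⟨h1, h2, h3⟩
    refine ⟨(chartAt V (rho p₀)).map_source h1, ?_, ?_⟩
    · simpa [(chartAt V (rho p₀)).left_inv h1] using h2
    · exact ⟨Complex.neg_pi_lt_arg _, lt_of_le_of_ne (Complex.arg_le_pi _)
        (Complex.slitPlane_arg_ne_pi h3)⟩
  map_target' := by
    rintro w ⟨h1, h2, h3⟩
    have hr := rho_circleInv p₀ h2
    refine ⟨?_, ?_, ?_⟩
    · rw [hr]; exact (chartAt V (rho p₀)).map_target h1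
    · rw [hr]; exact h2
    · rw [ratio_circleInv p₀ h2]
      rw [Complex.mem_slitPlane_iff_arg]
      have hpos := ratio_pos p₀ h2
      refine ⟨?_, mul_ne_zero (by exact_mod_cast hpos.ne') (Complex.exp_ne_zero _)⟩
      rw [Complex.arg_real_mul _ hpos, Complex.arg_exp_mul_I,
        (toIocMod_eq_self Real.two_pi_pos).2 ⟨h3.1, by linarith [h3.2]⟩]
      exact h3.2.ne
  left_inv' := by
    rintro p ⟨h1, h2, h3⟩
    have hl : (chartAt V (rho p₀)).symm (chartAt V (rho p₀) (rho p)) = rho p :=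
      (chartAt V (rho p₀)).left_inv h1
    have h2' : (chartAt V (rho p₀)).symm (chartAt V (rho p₀) (rho p)) ∈
        (trivializationAt ℂ E (rho p₀)).baseSet := by rw [hl]; exact h2
    refine (eq_of_coords (x₀ := rho p₀) h2 ?_ ?_).symm
    · rw [rho_circleInv p₀ h2', hl]
    · have hf0 := fiberCoord_ne_zero p₀ (mem_base p₀)
      have hr := ratio_circleInv p₀ (w := (chartAt V (rho p₀) (rho p),
        Complex.arg (fiberCoord (rho p₀) p / fiberCoord (rho p₀) p₀))) h2'
      rw [div_eq_iff hf0] at hr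
      have hn : ‖localFrame E (rho p₀) ((chartAt V (rho p₀)).symm (chartAt V (rho p₀) (rho p)))‖⁻¹
          = ‖fiberCoord (rho p₀) p‖ :=
        (congrArg (fun x => ‖localFrame E (rho p₀) x‖⁻¹) hl).trans (norm_fiberCoord p h2).symm
      rw [hr]
      simp only
      rw [hn, mul_comm (‖fiberCoord (rho p₀) p₀‖⁻¹), ← div_eq_mul_inv, ← norm_div,
        Complex.norm_mul_exp_arg_mul_I, div_mul_cancel₀ _ hf0]
  right_inv' := by
    rintro w ⟨h1, h2, h3⟩
    have hr := rho_circleInv p₀ h2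
    refine Prod.ext ?_ ?_
    · simp only [hr]; exact (chartAt V (rho p₀)).right_inv h1
    · simp only
      have hpos := ratio_pos p₀ h2
      rw [ratio_circleInv p₀ h2, Complex.arg_real_mul _ hpos, Complex.arg_exp_mul_I,
        (toIocMod_eq_self Real.two_pi_pos).2 ⟨h3.1, by linarith [h3.2]⟩]
  open_source := by
    have h1 : IsOpen (rho ⁻¹' (trivializationAt ℂ E (rho p₀)).baseSet : Set (CircleBundle E)) :=
      (trivializationAt ℂ E (rho p₀)).open_baseSet.preimage continuous_rho
    have h2 : IsOpen (rho ⁻¹' (chartAt V (rho p₀)).source : Set (CircleBundle E)) :=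
      (chartAt V (rho p₀)).open_source.preimage continuous_rho
    have h3 := ((continuousOn_fiberCoord (E := E) (rho p₀)).div_const
      (fiberCoord (rho p₀) p₀)).isOpen_inter_preimage h1 Complex.isOpen_slitPlane
    exact h2.inter h3
  open_target := by
    have h1 := (chartAt V (rho p₀)).isOpen_inter_preimage_symm
      (trivializationAt ℂ E (rho p₀)).open_baseSet
    have h2 : IsOpen (Ioo (-Real.pi) Real.pi) := isOpen_Ioo
    convert h1.prod h2 using 1
    ext w
    simp only [mem_ofPred_eq, mem_prod, mem_inter_iff, mem_preimage, and_assoc]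
  continuousOn_toFun := by
    refine ContinuousOn.prodMk ?_ ?_
    · exact (chartAt V (rho p₀)).continuousOn.comp continuous_rho.continuousOn fun p hp => hp.1
    · intro p hp
      have h1 : ContinuousWithinAt (fun p => fiberCoord (rho p₀) p / fiberCoord (rho p₀) p₀)
          {p : CircleBundle E | rho p ∈ (chartAt V (rho p₀)).source ∧
            rho p ∈ (trivializationAt ℂ E (rho p₀)).baseSet ∧
            fiberCoord (rho p₀) p / fiberCoord (rho p₀) p₀ ∈ Complex.slitPlane} p :=
        (((continuousOn_fiberCoord (E := E) (rho p₀)).div_const _).mono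
          fun q hq => hq.2.1) p hp
      exact ContinuousAt.comp_continuousWithinAt
        (f := fun p : CircleBundle E => fiberCoord (rho p₀) p / fiberCoord (rho p₀) p₀)
        (Complex.continuousAt_arg hp.2.2) h1
  continuousOn_invFun := by
    refine (Topology.IsInducing.subtypeVal.continuousOn_iff).2 ?_
    have hb : ContinuousOn (fun w : V × ℝ => (chartAt V (rho p₀)).symm w.1)
        {w | w.1 ∈ (chartAt V (rho p₀)).target ∧
          (chartAt V (rho p₀)).symm w.1 ∈ (trivializationAt ℂ E (rho p₀)).baseSet ∧
          w.2 ∈ Ioo (-Real.pi) Real.pi} :=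
      (chartAt V (rho p₀)).continuousOn_symm.comp continuous_fst.continuousOn fun w hw => hw.1
    have hn := (continuousOn_norm_frame (V := V) (E := E) (rho p₀)).comp hb fun w hw => hw.2.1
    have hinv := (continuousOn_const (c := ‖fiberCoord (rho p₀) p₀‖)).mul hn |>.inv₀
      (fun w hw => mul_ne_zero (norm_ne_zero_iff.2 (fiberCoord_ne_zero p₀ (mem_base p₀)))
        (norm_ne_zero_iff.2 (localFrame_ne_zero hw.2.1)))
    have hexp : Continuous fun w : V × ℝ =>
        fiberCoord (rho p₀) p₀ * Complex.exp (w.2 * Complex.I) := by fun_prop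
    have hz := (Complex.continuous_ofReal.comp_continuousOn hinv).mul hexp.continuousOn
    refine ((trivializationAt ℂ E (rho p₀)).toOpenPartialHomeomorph.continuousOn_symm.comp
      (hb.prodMk hz) ?_).congr ?_
    · intro w hw
      exact (trivializationAt ℂ E (rho p₀)).mem_target.2 hw.2.1
    · intro w hw
      exact circleInv_val p₀ hw.2.1

/-- The manifold structure of `SE`. -/
instance circleChartedSpace [SmoothHermitian V E] : ChartedSpace (V × ℝ) (CircleBundle E) where
  atlas := Set.range (circleChart V)
  chartAt := circleChart V
  mem_chart_source p := by
    refine ⟨mem_chart_source V (rho p), mem_base p, ?_⟩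
    rw [div_self (fiberCoord_ne_zero p (mem_base p))]
    exact Complex.one_mem_slitPlane
  chart_mem_atlas p := Set.mem_range_self p


theorem fiberCoord_change {x₀ x₁ : B} (p : CircleBundle E)
    (h0 : rho p ∈ (trivializationAt ℂ E x₀).baseSet)
    (h1 : rho p ∈ (trivializationAt ℂ E x₁).baseSet) :
    fiberCoord x₁ p = (trivializationAt ℂ E x₀).coordChangeL ℂ (trivializationAt ℂ E x₁) (rho p) 1
      * fiberCoord x₀ p := by
  have h := (trivializationAt ℂ E x₀).coordChangeL_apply (R := ℂ)
    (trivializationAt ℂ E x₁) ⟨h0, h1⟩ (fiberCoord x₀ p)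
  have h2 : (trivializationAt ℂ E x₀).symm (rho p) (fiberCoord x₀ p) = vec p :=
    (trivializationAt ℂ E x₀).symm_apply_apply_mk h0 (vec p)
  rw [h2] at h
  refine Eq.trans h.symm ?_
  have h3 := ((trivializationAt ℂ E x₀).coordChangeL ℂ (trivializationAt ℂ E x₁)
    (rho p)).map_smul (fiberCoord x₀ p) 1
  rw [smul_eq_mul, mul_one, smul_eq_mul] at h3
  rw [h3, mul_comm]

theorem contDiffAt_arg {z : ℂ} (hz : z ∈ Complex.slitPlane) : ContDiffAt ℝ ∞ Complex.arg z := by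
  have h : ContDiffAt ℝ ∞ Complex.log z := (Complex.contDiffAt_log hz).restrict_scalars ℝ
  exact (Complex.imCLM.contDiff.contDiffAt.comp z h).congr_of_eventuallyEq
    (Filter.Eventually.of_forall fun y => (Complex.log_im y).symm)

instance circleBundle_isManifold [IsManifold 𝓘(ℂ, V) ω B] [ContMDiffVectorBundle ω ℂ E 𝓘(ℂ, V)]
    [SmoothHermitian V E] : IsManifold 𝓘(ℝ, V × ℝ) ∞ (CircleBundle E) := by
  refine isManifold_of_contDiffOn _ _ _ ?_
  rintro _ _ ⟨p₀, rfl⟩ ⟨p₁, rfl⟩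
  simp only [modelWithCornersSelf_coe, modelWithCornersSelf_coe_symm, Function.id_comp,
    Function.comp_id, preimage_id, range_id, inter_univ]
  rintro w ⟨⟨hw1, hw2, hw3⟩, hw4, hw5, hw6⟩
  change w.1 ∈ _ at hw1
  change V × ℝ at w
  have hr := rho_circleInv p₀ hw2
  change rho (circleInv V p₀ w) ∈ _ at hw4
  change rho (circleInv V p₀ w) ∈ _ at hw5
  change fiberCoord (rho p₁) (circleInv V p₀ w) / _ ∈ _ at hw6
  apply ContDiffAt.contDiffWithinAt
  change ContDiffAt ℝ ∞ (fun w => (chartAt V (rho p₁) (rho (circleInv V p₀ w)),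
    Complex.arg (fiberCoord (rho p₁) (circleInv V p₀ w) / fiberCoord (rho p₁) p₁))) w
  have hsymm : ContMDiffAt 𝓘(ℂ, V) 𝓘(ℂ, V) ω (chartAt V (rho p₀)).symm w.1 :=
    (contMDiffOn_chart_symm (I := 𝓘(ℂ, V)) (x := rho p₀)).contMDiffAt
      ((chartAt V (rho p₀)).open_target.mem_nhds hw1)
  rw [hr] at hw4 hw5
  have hc : ContDiffAt ℝ ∞ (fun y => chartAt V (rho p₁) ((chartAt V (rho p₀)).symm y)) w.1 := by
    have h1 : ContMDiffAt 𝓘(ℂ, V) 𝓘(ℂ, V) ω (chartAt V (rho p₁)) ((chartAt V (rho p₀)).symm w.1) :=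
      (contMDiffOn_chart (I := 𝓘(ℂ, V)) (x := rho p₁)).contMDiffAt
        ((chartAt V (rho p₁)).open_source.mem_nhds hw4)
    have h2 := h1.comp w.1 hsymm
    exact ((contMDiffAt_iff_contDiffAt.1 h2).of_le le_top).restrict_scalars ℝ
  have hg : ContDiffAt ℝ ∞ (fun y => ((trivializationAt ℂ E (rho p₀)).coordChangeL ℂ
      (trivializationAt ℂ E (rho p₁)) ((chartAt V (rho p₀)).symm y) : ℂ →L[ℂ] ℂ) 1) w.1 := by
    have h1 := (contMDiffAt_coordChangeL (IB := 𝓘(ℂ, V)) (n := ω)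
      (e := trivializationAt ℂ E (rho p₀)) (e' := trivializationAt ℂ E (rho p₁)) hw2 hw5).comp
        w.1 hsymm
    have h2 := ((contMDiffAt_iff_contDiffAt.1 h1).of_le (m := ∞) le_top)
    exact (h2.clm_apply contDiffAt_const).restrict_scalars ℝ
  have hopen : {w : V × ℝ | w.1 ∈ (chartAt V (rho p₀)).target ∧
      (chartAt V (rho p₀)).symm w.1 ∈ (trivializationAt ℂ E (rho p₀)).baseSet ∩
        (trivializationAt ℂ E (rho p₁)).baseSet} ∈ 𝓝 w := by
    have h1 := (chartAt V (rho p₀)).isOpen_inter_preimage_symm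
      ((trivializationAt ℂ E (rho p₀)).open_baseSet.inter
        (trivializationAt ℂ E (rho p₁)).open_baseSet)
    exact (h1.preimage continuous_fst).mem_nhds ⟨hw1, hw2, hw5⟩
  have hratio : ∀ u : V × ℝ, (chartAt V (rho p₀)).symm u.1 ∈
      (trivializationAt ℂ E (rho p₀)).baseSet ∩ (trivializationAt ℂ E (rho p₁)).baseSet →
      ∃ r : ℝ, 0 < r ∧ fiberCoord (rho p₁) (circleInv V p₀ u) / fiberCoord (rho p₁) p₁ =
        r * (((trivializationAt ℂ E (rho p₀)).coordChangeL ℂ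
      (trivializationAt ℂ E (rho p₁)) ((chartAt V (rho p₀)).symm u.1) : ℂ →L[ℂ] ℂ) 1 *
        (fiberCoord (rho p₀) p₀ * Complex.exp (u.2 * Complex.I)) / fiberCoord (rho p₁) p₁) := by
    intro u hu
    have hru := rho_circleInv p₀ hu.1
    refine ⟨(‖fiberCoord (rho p₀) p₀‖ *
      ‖localFrame E (rho p₀) ((chartAt V (rho p₀)).symm u.1)‖)⁻¹, ?_, ?_⟩
    · exact inv_pos.2 (mul_pos (norm_pos_iff.2 (fiberCoord_ne_zero p₀ (mem_base p₀)))
        (norm_pos_iff.2 (localFrame_ne_zero hu.1)))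
    · rw [fiberCoord_change (x₀ := rho p₀) (circleInv V p₀ u) (hru ▸ hu.1) (hru ▸ hu.2),
        fiberCoord_circleInv p₀ hu.1]
      have hcc : (trivializationAt ℂ E (rho p₀)).coordChangeL ℂ (trivializationAt ℂ E (rho p₁))
          (rho (circleInv V p₀ u)) 1 = (trivializationAt ℂ E (rho p₀)).coordChangeL ℂ
          (trivializationAt ℂ E (rho p₁)) ((chartAt V (rho p₀)).symm u.1) 1 :=
        congrArg (fun x => (trivializationAt ℂ E (rho p₀)).coordChangeL ℂ
          (trivializationAt ℂ E (rho p₁)) x 1) hru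
      rw [hcc]
      simp only [ContinuousLinearEquiv.coe_coe]
      ring
  have hexp : ContDiff ℝ ∞ fun u : V × ℝ => Complex.exp (u.2 * Complex.I) :=
    Complex.contDiff_exp.comp ((Complex.ofRealCLM.contDiff.comp contDiff_snd).mul contDiff_const)
  have hz : ContDiffAt ℝ ∞ (fun u : V × ℝ => ((trivializationAt ℂ E (rho p₀)).coordChangeL ℂ
      (trivializationAt ℂ E (rho p₁)) ((chartAt V (rho p₀)).symm u.1) : ℂ →L[ℂ] ℂ) 1 *
        (fiberCoord (rho p₀) p₀ * Complex.exp (u.2 * Complex.I)) / fiberCoord (rho p₁) p₁) w :=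
    ((hg.comp w contDiffAt_fst).mul (contDiffAt_const.mul hexp.contDiffAt)).div_const _
  have hslit : ((trivializationAt ℂ E (rho p₀)).coordChangeL ℂ
      (trivializationAt ℂ E (rho p₁)) ((chartAt V (rho p₀)).symm w.1) : ℂ →L[ℂ] ℂ) 1 *
        (fiberCoord (rho p₀) p₀ * Complex.exp (w.2 * Complex.I)) / fiberCoord (rho p₁) p₁ ∈
        Complex.slitPlane := by
    obtain ⟨r, hr0, hr1⟩ := hratio w ⟨hw2, hw5⟩
    rw [hr1, Complex.mem_slitPlane_iff_arg, Complex.arg_real_mul _ hr0] at hw6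
    rw [Complex.mem_slitPlane_iff_arg]
    exact ⟨hw6.1, right_ne_zero_of_mul hw6.2⟩
  refine ((hc.comp w contDiffAt_fst).prodMk ((contDiffAt_arg hslit).comp w hz)).congr_of_eventuallyEq ?_
  filter_upwards [hopen] with u hu
  obtain ⟨r, hr0, hr1⟩ := hratio u hu.2
  rw [hr1, Complex.arg_real_mul _ hr0, rho_circleInv p₀ hu.2.1]
  rfl

end CircleBundle

/-! ### Tensor powers of a Hermitian line -/
section LinePower
variable (L : Type*) [NormedAddCommGroup L] [InnerProductSpace ℂ L]

/-- `L^m`: `L ⊗ ⋯ ⊗ L` for `m ≥ 0` (`ℂ` for `m = 0`), and `L* ⊗ ⋯ ⊗ L*` (`|m|` factors) for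
`m < 0`. -/
def LinePow : ℤ → Type _
  | Int.ofNat n => ⨂[ℂ]^n L
  | Int.negSucc n => ⨂[ℂ]^(n + 1) (Module.Dual ℂ L)

instance : ∀ m : ℤ, AddCommGroup (LinePow L m)
  | Int.ofNat n => inferInstanceAs (AddCommGroup (⨂[ℂ]^n L))
  | Int.negSucc n => inferInstanceAs (AddCommGroup (⨂[ℂ]^(n + 1) (Module.Dual ℂ L)))

instance : ∀ m : ℤ, Module ℂ (LinePow L m)
  | Int.ofNat n => inferInstanceAs (Module ℂ (⨂[ℂ]^n L))
  | Int.negSucc n => inferInstanceAs (Module ℂ (⨂[ℂ]^(n + 1) (Module.Dual ℂ L)))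

variable {L}

/-- The element `s*` of the dual line that is dual to `s ≠ 0`, that is, `s*(s) = 1`. -/
def dualVec (s : L) : Module.Dual ℂ L :=
  ((‖s‖ ^ 2 : ℝ) : ℂ)⁻¹ • (innerSL ℂ s).toLinearMap

/-- The power `s^m = s ⊗ ⋯ ⊗ s`, or `s* ⊗ ⋯ ⊗ s*` if `m < 0`. For unit `s` it is the value at
`s` of the covering map `℘_m : SL → SL^m`. -/
def vecPow : ∀ (m : ℤ) (_ : L), LinePow L m
  | Int.ofNat _, s => PiTensorProduct.tprod ℂ (fun _ => s)
  | Int.negSucc _, s => PiTensorProduct.tprod ℂ (fun _ => dualVec s)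

/-- The linear form `η ↦ ⟨s^{-m}, η⟩` on `L^m`, for the canonical pairing of `L^{-m}` with `L^m`:
`⟨s* ⊗ ⋯ ⊗ s*, v₁ ⊗ ⋯ ⊗ v_m⟩ = ∏ s*(v_i)` and `⟨s ⊗ ⋯ ⊗ s, ℓ₁ ⊗ ⋯ ⊗ ℓ_|m|⟩ = ∏ ℓ_i(s)`. -/
def pairPow : ∀ (m : ℤ) (_ : L), LinePow L m →ₗ[ℂ] ℂ
  | Int.ofNat n, s => PiTensorProduct.lift
      ((MultilinearMap.mkPiAlgebra ℂ (Fin n) ℂ).compLinearMap fun _ => dualVec s)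
  | Int.negSucc n, s => PiTensorProduct.lift
      ((MultilinearMap.mkPiAlgebra ℂ (Fin (n + 1)) ℂ).compLinearMap
        fun _ => Module.Dual.eval ℂ L s)

variable (V : Type*) [NormedAddCommGroup V] [NormedSpace ℂ V]

instance (m : ℤ) (q : ℕ) : AddCommGroup (FormZeroQ V q ⊗[ℂ] LinePow L m) :=
  @TensorProduct.addCommGroup ℂ _ (FormZeroQ V q) (LinePow L m) (Submodule.addCommGroup _) _ _ _

/-- The contraction `⟨s^{-m}, ·⟩ : Λ^{0,q} ⊗ L^m → Λ^{0,q}`. -/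
def contract (m : ℤ) (q : ℕ) (s : L) :
    FormZeroQ V q ⊗[ℂ] LinePow L m →ₗ[ℂ] FormZeroQ V q :=
  (TensorProduct.rid ℂ (FormZeroQ V q)).toLinearMap ∘ₗ
    LinearMap.lTensor (FormZeroQ V q) (pairPow m s)

end LinePower

/-! ### Differential forms on a manifold -/
section Forms
variable {W : Type*} [NormedAddCommGroup W] [NormedSpace ℝ W]
  {M : Type*} [TopologicalSpace M] [ChartedSpace W M] {k : ℕ}

/-- The expression of a complex-valued `k`-form in the preferred chart at `p`: its pull-back by
the inverse of that chart. As in Mathlib, `T_x M` is identified with the model space `W` by the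
preferred chart at `x`. -/
def chartRep (α : M → W [⋀^Fin k]→L[ℝ] ℂ) (p : M) (y : W) : W [⋀^Fin k]→L[ℝ] ℂ :=
  (α ((chartAt W p).symm y)).compContinuousLinearMap
    (mfderiv 𝓘(ℝ, W) 𝓘(ℝ, W) (chartAt W p).symm y)

/-- The form `α` is `C^∞`. -/
def SmoothForm (α : M → W [⋀^Fin k]→L[ℝ] ℂ) : Prop :=
  ∀ p : M, ContDiffOn ℝ ∞ (chartRep α p) (chartAt W p).target

/-- The exterior derivative of a form on a manifold, computed at `p` in the preferred chart at
`p`. -/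
def extD (α : M → W [⋀^Fin k]→L[ℝ] ℂ) (p : M) : W [⋀^Fin (k + 1)]→L[ℝ] ℂ :=
  extDeriv (chartRep α p) (chartAt W p p)

theorem chartRep_add (α α' : M → W [⋀^Fin k]→L[ℝ] ℂ) (p : M) :
    chartRep (α + α') p = chartRep α p + chartRep α' p := rfl

theorem chartRep_smul (c : ℂ) (α : M → W [⋀^Fin k]→L[ℝ] ℂ) (p : M) :
    chartRep (c • α) p = c • chartRep α p := rfl

theorem chartRep_zero (p : M) : chartRep (0 : M → W [⋀^Fin k]→L[ℝ] ℂ) p = 0 := rfl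

theorem extD_add {α α' : M → W [⋀^Fin k]→L[ℝ] ℂ} {p : M}
    (h : DifferentiableAt ℝ (chartRep α p) (chartAt W p p))
    (h' : DifferentiableAt ℝ (chartRep α' p) (chartAt W p p)) :
    extD (α + α') p = extD α p + extD α' p := by
  rw [extD, chartRep_add, extDeriv_add h h']; rfl

theorem extD_smul (c : ℂ) {α : M → W [⋀^Fin k]→L[ℝ] ℂ} {p : M}
    (h : DifferentiableAt ℝ (chartRep α p) (chartAt W p p)) :
    extD (c • α) p = c • extD α p := by
  rw [extD, chartRep_smul, extDeriv, fderiv_const_smul h]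
  ext v
  simp [extD, extDeriv, ContinuousAlternatingMap.alternatizeUncurryFin_apply, Finset.mul_sum]

end Forms

/-! ### Cohomology -/
section Cohomology
variable {X : ℕ → Type*} [∀ q, AddCommGroup (X q)] [∀ q, Module ℂ (X q)]
  (A : ∀ q, Submodule ℂ (X q)) (d : ∀ q, A q →ₗ[ℂ] X (q + 1))

/-- The image in degree `q` of the differential of the complex `⋯ → A q → A (q + 1) → ⋯`. -/
def coboundaries : ∀ q, Submodule ℂ (X q)
  | 0 => ⊥
  | q + 1 => LinearMap.range (d q)

/-- The cohomology group in degree `q` of the complex `⋯ → A q → A (q + 1) → ⋯`, starting with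
`A 0`: the kernel of `d` on `A q` modulo `d (A (q - 1))`. -/
abbrev Cohomology (q : ℕ) : Type _ :=
  LinearMap.ker (d q) ⧸
    (coboundaries A d q).comap ((A q).subtype ∘ₗ (LinearMap.ker (d q)).subtype)

/-- The class of a cocycle. -/
abbrev cohomologyClass (q : ℕ) : LinearMap.ker (d q) →ₗ[ℂ] Cohomology A d q :=
  Submodule.mkQ _

end Cohomology

section LineBundle
variable (V : Type*) [NormedAddCommGroup V] [NormedSpace ℂ V]
  {B : Type*} [TopologicalSpace B] [ChartedSpace V B]
  (E : B → Type*) [∀ x, NormedAddCommGroup (E x)] [∀ x, InnerProductSpace ℂ (E x)]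
  [TopologicalSpace (TotalSpace ℂ E)] [FiberBundle ℂ E] [VectorBundle ℂ ℂ E]

/-! ### The Dolbeault complex of `E^m` -/

/-- Sections, not necessarily smooth, of `Λ^{0,q} B ⊗ E^m`. -/
abbrev BundleForm (m : ℤ) (q : ℕ) : Type _ := ∀ x : B, FormZeroQ V q ⊗[ℂ] LinePow (E x) m

variable {E}

/-- The coefficient `φ` of `η = φ ⊗ σ^m` with respect to the holomorphic frame `σ` of `E` given by
the preferred trivialization at `x₀`. -/
def coeff (m : ℤ) (q : ℕ) (x₀ : B) (η : BundleForm V E m q) (x : B) : V [⋀^Fin q]→L[ℝ] ℂ :=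
  contract V m q (localFrame E x₀ x) (η x)

variable (E)

/-- `C^∞(B; Λ^{0,q} B ⊗ E^m)`: the coefficients with respect to the local holomorphic frames
are smooth. -/
def dolbeaultForms (m : ℤ) (q : ℕ) : Submodule ℂ (BundleForm V E m q) where
  carrier := {η | ∀ x₀ : B, ContDiffOn ℝ ∞ (chartRep (coeff V m q x₀ η) x₀)
    ((chartAt V x₀).target ∩ (chartAt V x₀).symm ⁻¹' (trivializationAt ℂ E x₀).baseSet)}
  add_mem' := by
    intro η η' h h' x₀
    have : coeff V m q x₀ (η + η') = coeff V m q x₀ η + coeff V m q x₀ η' := by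
      funext x; simp [coeff]
    rw [this, chartRep_add]
    exact (h x₀).add (h' x₀)
  zero_mem' := by
    intro x₀
    have : coeff V m q x₀ (0 : BundleForm V E m q) = 0 := by funext x; simp [coeff]
    rw [this, chartRep_zero]
    exact contDiffOn_const
  smul_mem' := by
    intro c η h x₀
    have : coeff V m q x₀ (c • η) = c • coeff V m q x₀ η := by funext x; simp [coeff]
    rw [this, chartRep_smul]
    exact (h x₀).const_smul c

variable {E}

/-- `∂̄` on `E^m`-valued `(0,q)`-forms: `∂̄(φ ⊗ σ^m) = ∂̄φ ⊗ σ^m` if `σ` is a local holomorphic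
frame of `E`, with `∂̄φ` the component of type `(0,q+1)` of `dφ`. -/
def dbar (m : ℤ) (q : ℕ) (η : BundleForm V E m q) : BundleForm V E m (q + 1) := fun x =>
  projZeroQ V (q + 1) (extD (coeff V m q x η) x) ⊗ₜ[ℂ] vecPow m (localFrame E x x)

theorem differentiableAt_coeff {m : ℤ} {q : ℕ} (η : dolbeaultForms V E m q) (x : B) :
    DifferentiableAt ℝ (chartRep (coeff V m q x η.1) x) (chartAt V x x) := by
  refine ((η.2 x).contDiffAt (((chartAt V x).isOpen_inter_preimage_symm
    (trivializationAt ℂ E x).open_baseSet).mem_nhds ?_)).differentiableAt (by simp)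
  refine ⟨mem_chart_target V x, ?_⟩
  rw [mem_preimage, (chartAt V x).left_inv (mem_chart_source V x)]
  exact mem_baseSet_trivializationAt ℂ E x

variable (E)

/-- `∂̄` as a linear map on `C^∞(B; Λ^{0,q} B ⊗ E^m)`. -/
def dbarLin (m : ℤ) (q : ℕ) : dolbeaultForms V E m q →ₗ[ℂ] BundleForm V E m (q + 1) where
  toFun η := dbar V m q η.1
  map_add' η η' := by
    funext x
    have : coeff V m q x (η + η').1 = coeff V m q x η.1 + coeff V m q x η'.1 := by
      funext x; simp [coeff]
    simp only [dbar, Pi.add_apply]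
    rw [this, extD_add (differentiableAt_coeff V η x) (differentiableAt_coeff V η' x), map_add,
      TensorProduct.add_tmul]
  map_smul' c η := by
    funext x
    have : coeff V m q x (c • η).1 = c • coeff V m q x η.1 := by
      funext x; simp [coeff]
    simp only [dbar, Pi.smul_apply, RingHom.id_apply]
    rw [this, extD_smul c (differentiableAt_coeff V η x), map_smul, TensorProduct.smul_tmul']

/-! ### The geometry of the circle bundle -/
variable {E}

/-- The action of `e^{it}` on the circle bundle; these maps form the flow of `𝒯`. -/
def circleAct (t : ℝ) (p : CircleBundle E) : CircleBundle E :=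
  ⟨⟨rho p, Complex.exp (t * Complex.I) • vec p⟩, by
    have h : ‖vec p‖ = 1 := p.2
    simp [norm_smul, Complex.norm_exp_ofReal_mul_I, h]⟩

/-- The `(1,0)`-form `∂ log |σ|²` at `x`, where `σ` is the holomorphic frame at `x₀`: the connection
form, with respect to `σ`, of the Hermitian holomorphic connection, `∇σ = (∂ log |σ|²) ⊗ σ`. -/
def chernForm (x₀ x : B) : V →L[ℝ] ℂ :=
  let dg : V →L[ℝ] ℂ := Complex.ofRealCLM ∘L
    (mfderiv 𝓘(ℝ, V) 𝓘(ℝ, ℝ) (fun x => Real.log (‖localFrame E x₀ x‖ ^ 2)) x : V →L[ℝ] ℝ)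
  (1 / 2 : ℂ) • (dg - Complex.I • (dg ∘L mulI V))

variable [SmoothHermitian V E]

/-- The differential of `ρ : SE → B` at `p`. -/
def dRho (p : CircleBundle E) : V × ℝ →L[ℝ] V :=
  mfderiv 𝓘(ℝ, V × ℝ) 𝓘(ℝ, V) (rho : CircleBundle E → B) p

theorem dRho_eq (p : CircleBundle E) : dRho V p = ContinuousLinearMap.fst ℝ V ℝ := by
  refine HasMFDerivAt.mfderiv (f' := ContinuousLinearMap.fst ℝ V ℝ)
    ⟨continuous_rho.continuousAt, ?_⟩
  apply HasFDerivAt.hasFDerivWithinAt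
  refine (ContinuousLinearMap.hasFDerivAt _).congr_of_eventuallyEq ?_
  have : (chartAt (V × ℝ) p).target ∈ 𝓝 (extChartAt 𝓘(ℝ, V × ℝ) p p) := by
    simpa using (chartAt (V × ℝ) p).open_target.mem_nhds (mem_chart_target _ p)
  filter_upwards [this] with w hw
  have hw' : w.1 ∈ (chartAt V (rho p)).target ∧
    (chartAt V (rho p)).symm w.1 ∈ (trivializationAt ℂ E (rho p)).baseSet ∧
    w.2 ∈ Ioo (-Real.pi) Real.pi := hw
  simp only [writtenInExtChartAt, mfld_simps]
  change chartAt V (rho p) (rho (circleInv V p w)) = w.1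
  rw [rho_circleInv p hw'.2.1]
  exact (chartAt V (rho p)).right_inv hw'.1

/-- The vector field `𝒯`, the infinitesimal generator of the circle action. -/
def vecT (p : CircleBundle E) : V × ℝ :=
  (mfderiv 𝓘(ℝ, ℝ) 𝓘(ℝ, V × ℝ) (fun t : ℝ => circleAct t p) 0 : ℝ →L[ℝ] V × ℝ) 1

/-- The connection form `θ` on `SE` of the Hermitian holomorphic connection: if `p = f σ` with
`σ` a local holomorphic frame of `E`, then the covariant derivative of `p` is
`(df + f ∂ log |σ|²) ⊗ σ = iθ ⊗ p`, so `iθ = df / f + ∂ log |σ|²`. The right hand side is purely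
imaginary on `SE`, and `θ` is its imaginary part. -/
def theta (p : CircleBundle E) : V × ℝ →L[ℝ] ℝ :=
  let df : V × ℝ →L[ℝ] ℂ :=
    mfderiv 𝓘(ℝ, V × ℝ) 𝓘(ℝ, ℂ) (fiberCoord (rho p) : CircleBundle E → ℂ) p
  Complex.imCLM ∘L
    ((fiberCoord (rho p) p)⁻¹ • df + chernForm (E := E) V (rho p) (rho p) ∘L dRho V p)

/-- The horizontal lift `T_{ρ(p)} B → ker θ ⊂ T_p SE`: by `dRho_eq`, the vector `(a, 0)` projects to
`a`, and subtracting a multiple of `𝒯` puts it in `ker θ`. -/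
def hLift (p : CircleBundle E) : V →L[ℝ] V × ℝ :=
  ContinuousLinearMap.inl ℝ V ℝ -
    ((theta V p) ∘L ContinuousLinearMap.inl ℝ V ℝ).smulRight (vecT V p)

/-- `v ↦ J v_H`, with `v_H` the component of `v` in `H = ker θ` along `𝒯`, and `J` the complex
structure of `H` that corresponds to that of `B`. -/
def opJ (p : CircleBundle E) : V × ℝ →L[ℝ] V × ℝ :=
  hLift V p ∘L mulI V ∘L dRho V p

/-! ### The `∂̄_b` complex of the circle bundle

`V̄ ⊂ ℂTSE` is the bundle of the `v` with `ρ_* v` of type `(0,1)`, `K̄ = V̄ ∩ ker θ` is the CR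
structure and `K` is its conjugate, so that `ℂTSE = K ⊕ V̄` and `V̄ = K̄ ⊕ ℂ𝒯`. A real vector `v` has
components `v_H` in `H = ker θ` and `θ(v)𝒯`, and its component in `V̄` along `K` is
`(v_H + iJv_H)/2 + θ(v)𝒯`.

A section of `Λ^k V̄*` is represented by its extension to `ℂTSE` that vanishes if one argument is
in `K`. Such a form is determined by its values on real vectors, and is given as a complex-valued
form on `TSE`. -/

/-- The restriction of complex-valued `k`-forms on `T_p SE` to `V̄`, represented as above:
`v ↦ α_ℂ(πv₁, …, πv_k)`, with `πv = (v_H + iJv_H)/2 + θ(v)𝒯 = (v + θ(v)𝒯)/2 + i Jv_H/2`. -/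
def restrictVbar (p : CircleBundle E) {k : ℕ} :
    ((V × ℝ) [⋀^Fin k]→L[ℝ] ℂ) →ₗ[ℂ] ((V × ℝ) [⋀^Fin k]→L[ℝ] ℂ) :=
  complexPullback k
    ((1 / 2 : ℝ) • (ContinuousLinearMap.id ℝ (V × ℝ) + (theta V p).smulRight (vecT V p)))
    ((1 / 2 : ℝ) • opJ V p)

/-- `Λ^q K̄*` at `p`, the forms in `Λ^q V̄*` that are annihilated by the interior product with `𝒯`:
they vanish if one argument is `𝒯`, or is in `K`, that is, of the form `v - iJv` with `v ∈ H`. -/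
def FormKbar (p : CircleBundle E) (q : ℕ) : Submodule ℂ ((V × ℝ) [⋀^Fin q]→L[ℝ] ℂ) where
  carrier := {φ | (∀ (v : Fin q → V × ℝ) (j : Fin q), v j = vecT V p → φ v = 0) ∧
    ∀ (v : Fin q → V × ℝ) (j : Fin q), theta V p (v j) = 0 →
      φ (Function.update v j (opJ V p (v j))) = -Complex.I * φ v}
  add_mem' := by
    rintro a b ⟨ha, ha'⟩ ⟨hb, hb'⟩
    refine ⟨fun v j h => ?_, fun v j h => ?_⟩
    · simp [ha v j h, hb v j h]
    · simp only [ContinuousAlternatingMap.add_apply, ha' v j h, hb' v j h]; ring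
  zero_mem' := by simp
  smul_mem' := by
    rintro c a ⟨ha, ha'⟩
    refine ⟨fun v j h => ?_, fun v j h => ?_⟩
    · simp [ha v j h]
    · simp only [ContinuousAlternatingMap.smul_apply, smul_eq_mul, ha' v j h]; ring

variable (E) in
/-- Complex-valued `q`-forms, not necessarily smooth, on `SE`. -/
abbrev CircleForm (q : ℕ) : Type _ := CircleBundle E → (V × ℝ) [⋀^Fin q]→L[ℝ] ℂ

/-- The operator `D̄` of the complex `Γ(Λ^q V̄*) → Γ(Λ^{q+1} V̄*)`: the restriction to `V̄` of the
exterior derivative. -/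
def dVbar (q : ℕ) (φ : CircleForm V E q) : CircleForm V E (q + 1) := fun p =>
  restrictVbar V p (extD φ p)

/-- The form `β = -iθ` on `V̄`; it vanishes on `K` as it stands. -/
def beta (p : CircleBundle E) : V × ℝ →L[ℝ] ℂ :=
  (-Complex.I) • (Complex.ofRealCLM ∘L theta V p)

/-- The pull-back `𝔞_t^* φ`, with `𝔞_t` the action of `e^{it}`. -/
def flowPullback (q : ℕ) (φ : CircleForm V E q) (t : ℝ) : CircleForm V E q := fun p =>
  (φ (circleAct t p)).compContinuousLinearMap
    (mfderiv 𝓘(ℝ, V × ℝ) 𝓘(ℝ, V × ℝ) (circleAct t : CircleBundle E → CircleBundle E) p)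

/-- The Lie derivative `ℒ_𝒯 φ = d/dt 𝔞_t^* φ` at `t = 0`. -/
def lieT (q : ℕ) (φ : CircleForm V E q) : CircleForm V E q := fun p =>
  deriv (fun t => flowPullback V q φ t p) 0

/-- The operator `∂̄_b φ = D̄φ - iβ ∧ ℒ_𝒯 φ`. -/
def dbarB (q : ℕ) (φ : CircleForm V E q) : CircleForm V E (q + 1) := fun p =>
  dVbar V q φ p - Complex.I • wedgeOne q (beta V p) (lieT V q φ p)

variable (E)

/-- `C^∞_m(SE; Λ^q K̄*)`: the smooth sections `φ` of `Λ^q K̄*` with `ℒ_𝒯 φ + imφ = 0`. -/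
def fourierForms (m : ℤ) (q : ℕ) : Submodule ℂ (CircleForm V E q) where
  carrier := {φ | SmoothForm φ ∧ (∀ p, φ p ∈ FormKbar V p q) ∧
    ∀ p, HasDerivAt (fun t => flowPullback V q φ t p) (-(Complex.I * m) • φ p) 0}
  add_mem' := by
    rintro φ φ' ⟨h1, h2, h3⟩ ⟨h1', h2', h3'⟩
    refine ⟨fun p => ?_, fun p => (FormKbar V p q).add_mem (h2 p) (h2' p), fun p => ?_⟩
    · rw [chartRep_add]; exact (h1 p).add (h1' p)
    · rw [Pi.add_apply, smul_add]
      exact (h3 p).add (h3' p)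
  zero_mem' := by
    refine ⟨fun p => ?_, fun p => (FormKbar V p q).zero_mem, fun p => ?_⟩
    · rw [chartRep_zero]; exact contDiffOn_const
    · rw [Pi.zero_apply, smul_zero]
      exact hasDerivAt_const 0 0
  smul_mem' := by
    rintro c φ ⟨h1, h2, h3⟩
    refine ⟨fun p => ?_, fun p => (FormKbar V p q).smul_mem c (h2 p), fun p => ?_⟩
    · rw [chartRep_smul]; exact (h1 p).const_smul c
    · rw [Pi.smul_apply, smul_comm]
      exact (h3 p).const_smul c

theorem differentiableAt_chartRep {m : ℤ} {q : ℕ} (φ : fourierForms V E m q)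
    (p : CircleBundle E) : DifferentiableAt ℝ (chartRep φ.1 p) (chartAt (V × ℝ) p p) :=
  ((φ.2.1 p).contDiffAt ((chartAt (V × ℝ) p).open_target.mem_nhds
    (mem_chart_target _ p))).differentiableAt (by simp)

theorem lieT_eq {m : ℤ} {q : ℕ} (φ : fourierForms V E m q) :
    lieT V q φ.1 = -(Complex.I * m) • φ.1 :=
  funext fun p => (φ.2.2.2 p).deriv

/-- `∂̄_b` as a linear map on `C^∞_m(SE; Λ^q K̄*)`. -/
def dbarBLin (m : ℤ) (q : ℕ) : fourierForms V E m q →ₗ[ℂ] CircleForm V E (q + 1) where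
  toFun φ := dbarB V q φ.1
  map_add' φ φ' := by
    funext p
    simp only [dbarB, dVbar, lieT_eq, Pi.add_apply]
    rw [Submodule.coe_add, extD_add (differentiableAt_chartRep V E φ p)
      (differentiableAt_chartRep V E φ' p), map_add]
    simp only [Pi.smul_apply, Pi.add_apply, smul_add, map_add]
    abel
  map_smul' c φ := by
    funext p
    simp only [dbarB, dVbar, lieT_eq, Pi.smul_apply, RingHom.id_apply]
    rw [Submodule.coe_smul, extD_smul c (differentiableAt_chartRep V E φ p), map_smul]
    simp only [Pi.smul_apply, map_smul, smul_sub, smul_comm c]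

/-- The map `F_m`, `F_m(η)(p) = ρ_p^* ⟨p^{-m}, η(ρ(p))⟩`. -/
def mapF (m : ℤ) (q : ℕ) : BundleForm V E m q →ₗ[ℂ] CircleForm V E q where
  toFun η p := ((contract V m q (vec p) (η (rho p)) : FormZeroQ V q) :
    V [⋀^Fin q]→L[ℝ] ℂ).compContinuousLinearMap (dRho V p)
  map_add' η η' := by funext p; ext v; simp
  map_smul' c η := by funext p; ext v; simp

/-- The Dolbeault cohomology group of `E^m` in degree `(0,q)`. -/
abbrev DolbeaultCohomology (m : ℤ) (q : ℕ) : Type _ :=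
  Cohomology (X := BundleForm V E m) (dolbeaultForms V E m) (dbarLin V E m) q

/-- The cohomology group in degree `q` of the complex
`⋯ → C^∞_m(SE; Λ^q K̄*) → C^∞_m(SE; Λ^{q+1} K̄*) → ⋯` with differential `∂̄_b`. -/
abbrev FourierCohomology (m : ℤ) (q : ℕ) : Type _ :=
  Cohomology (X := CircleForm V E) (fourierForms V E m) (dbarBLin V E m) q

/-- The cohomology class of a `∂̄`-closed form. -/
abbrev dolbeaultClass (m : ℤ) (q : ℕ) :
    LinearMap.ker (dbarLin V E m q) →ₗ[ℂ] DolbeaultCohomology V E m q :=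
  cohomologyClass (X := BundleForm V E m) (dolbeaultForms V E m) (dbarLin V E m) q

/-- The cohomology class of a `∂̄_b`-closed form in `C^∞_m(SE; Λ^q K̄*)`. -/
abbrev fourierClass (m : ℤ) (q : ℕ) :
    LinearMap.ker (dbarBLin V E m q) →ₗ[ℂ] FourierCohomology V E m q :=
  cohomologyClass (X := CircleForm V E) (fourierForms V E m) (dbarBLin V E m) q

end LineBundle
end CircleBundleCR

end

open CircleBundleCR

/-!
# Forms on the circle bundle and the Dolbeault complex of the powers of a line bundle

Let `σ` be a local holomorphic frame of `E` and let `f` be the fibre coordinate on `SE`, so that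
`p = f(p) σ`. If `η = φ ⊗ σ^m`, then `F_m(η) = f^{-m} ρ^*φ` (`mapF_eq_coeff`). In the charts of `SE`
this reads the same, with `f` the function `c · exp (-log |σ|² / 2 + it)`, because the coordinate
changes of `SE` are over those of `B` and `|f| |σ| = 1` on `SE` (`chartRep_mapF`,
`fiberCoord_circleInv_eq_exp`). The theorem follows from this formula.

* `F_m` is bijective. The circle action is `t ↦ t + s` in the charts, so the solutions of
  `ℒ_𝒯 φ + imφ = 0` are the forms with `φ(e^{it}p) = e^{-imt} φ(p)` (`fourierForms_circleAct`). An
  element of `Λ^q K̄*` at `p` is the pull-back of a unique form `α_p` of type `(0,q)` on `B`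
  (`FormKbar.eq_comp_fst`, `FormKbar.comp_inl_mem`), and then `α_p ⊗ p^m` depends only on `ρ(p)`. It
  is the form `η` with `F_m(η) = φ`, and its coefficient is `f^m α_p` (`exists_mapF_eq`).

* `∂̄` is well defined and `∂̄² = 0`. A change of the frame multiplies the coefficient by a
  holomorphic function, the differential of which is of type `(1,0)`, and the transition maps of `B`
  are holomorphic, so `∂̄` is in every holomorphic chart and frame the component of type `(0,q+1)`
  of `d` (`coeff_dbar`, `chartRep_coeff_dbar`). Since the `(0,q+1)`-component of `dω` depends only
  on the `(0,q)`-component of `ω` (`projZeroQ_extDeriv`), `∂̄² = 0` follows from `d² = 0`.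

* `∂̄_b F_m = F_m ∂̄` (`dbarB_mapF`). The connection form satisfies `df = f (iθ - ρ^*∂ log |σ|²)`
  (`hasFDerivAt_fiberCoord`), and the `(1,0)`-form `∂ log |σ|²` disappears on `V̄`. Hence
  `D̄(f^{-m} ρ^*φ) = -imθ ∧ f^{-m} ρ^*φ + f^{-m} ρ^*∂̄φ`, and the first term is cancelled by
  `-iβ ∧ ℒ_𝒯 F_m(η)`.

The operators `∂̄_b` thus inherit the properties of a complex from `∂̄`, and an isomorphism of
complexes induces isomorphisms in cohomology (`exists_cohomology_equiv`).
-/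

noncomputable section
namespace CircleBundleCR

/-! ### Complexified pull-backs of alternating forms -/
section Algebra
variable {U W : Type*} [NormedAddCommGroup U] [NormedSpace ℝ U]
  [NormedAddCommGroup W] [NormedSpace ℝ W]

theorem two_le_infty : (2 : WithTop ℕ∞) ≤ ∞ :=
  WithTop.coe_le_coe.2 (le_top : (2 : ℕ∞) ≤ ⊤)

set_option synthInstance.maxHeartbeats 200000 in
theorem contDiffAt_extDeriv {F : Type*} [NormedAddCommGroup F] [NormedSpace ℝ F] {k : ℕ}
    {γ : W → W [⋀^Fin k]→L[ℝ] F} {x : W} (hγ : ContDiffAt ℝ ∞ γ x) :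
    ContDiffAt ℝ ∞ (extDeriv γ) x := by
  have h := hγ.fderiv_right (m := ∞) (by simp)
  exact (ContinuousAlternatingMap.alternatizeUncurryFinCLM (n := k) ℝ W
    F).contDiff.contDiffAt.comp x h

theorem contDiff_compContinuousLinearMap {F : Type*} [NormedAddCommGroup F] [NormedSpace ℝ F]
    {k : ℕ} (L : U →L[ℝ] W) {n : WithTop ℕ∞} :
    ContDiff ℝ n fun α : W [⋀^Fin k]→L[ℝ] F => α.compContinuousLinearMap L := by
  let T : (W [⋀^Fin k]→L[ℝ] F) →L[ℝ] (U [⋀^Fin k]→L[ℝ] F) :=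
    ContinuousAlternatingMap.compContinuousLinearMapCLM L
  exact T.contDiff

/-- The subsets of `Fin k` in `complexPullbackForm_apply`, written as `Bool`-valued functions, so
that the sum over them splits along `Fin.insertNthEquiv`. -/
theorem complexPullback_apply_bool {k : ℕ} (α : W [⋀^Fin k]→L[ℝ] ℂ) (A B : U →L[ℝ] W)
    (v : Fin k → U) :
    complexPullback k A B α v = ∑ b : Fin k → Bool,
      (∏ j, if b j then Complex.I else 1) * α (fun j => if b j then B (v j) else A (v j)) := by
  classical
  refine (complexPullbackForm_apply α A B v).trans ?_
  refine Finset.sum_bij' (fun S _ j => decide (j ∈ S)) (fun b _ => Finset.univ.filter (b · = true))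
    (by simp) (by simp) (by intro S _; ext; simp) (by intro b _; funext; simp) ?_
  intro S _
  simp

/-- The `ℂ`-multilinear extension of `∑ (-1)^j f(v_j)(v₀, …, v̂_j, …, v_k)` may be computed
term by term. -/
theorem complexPullback_alternatize {k : ℕ} (A B : U →L[ℝ] W) (f : W →L[ℝ] W [⋀^Fin k]→L[ℝ] ℂ)
    (g : U →L[ℝ] U [⋀^Fin k]→L[ℝ] ℂ)
    (hg : ∀ u, g u = complexPullback k A B (f (A u)) +
      Complex.I • complexPullback k A B (f (B u))) :
    complexPullback (k + 1) A B (.alternatizeUncurryFin f) = .alternatizeUncurryFin g := by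
  ext v
  rw [complexPullback_apply_bool, ContinuousAlternatingMap.alternatizeUncurryFin_apply]
  simp only [ContinuousAlternatingMap.alternatizeUncurryFin_apply, Finset.mul_sum]
  rw [Finset.sum_comm]
  refine Finset.sum_congr rfl fun i _ => ?_
  rw [hg, ← (Fin.insertNthEquiv (fun _ => Bool) i).sum_comp, Fintype.sum_prod_type,
    Fintype.sum_bool, ContinuousAlternatingMap.add_apply, ContinuousAlternatingMap.smul_apply,
    complexPullback_apply_bool, complexPullback_apply_bool, smul_add, add_comm, Finset.smul_sum,
    Finset.smul_sum, Finset.smul_sum]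
  have hr : ∀ (c : Bool) (b : Fin k → Bool),
      (i.removeNth fun j => if i.insertNth (α := fun _ => Bool) c b j then B (v j) else A (v j)) =
        fun j => if b j then B (i.removeNth v j) else A (i.removeNth v j) := by
    intro c b
    funext j
    simp [Fin.removeNth]
  congr 1 <;>
  · refine Finset.sum_congr rfl fun b _ => ?_
    simp only [Fin.insertNthEquiv_apply, Fin.prod_univ_succAbove _ i, hr, Fin.insertNth_apply_same,
      Fin.insertNth_apply_succAbove, if_true, Bool.false_eq_true, if_false, zsmul_eq_mul,
      smul_eq_mul]
    ring

/-- The `ℂ`-multilinear extension of `β ∧ φ` at the vectors `A v + iB v`: the form `β` contributes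
`v ↦ β(A v) + iβ(B v)`. -/
theorem complexPullback_wedgeOne {k : ℕ} (A B : U →L[ℝ] W) (β : W →L[ℝ] ℂ)
    (φ : W [⋀^Fin k]→L[ℝ] ℂ) :
    complexPullback (k + 1) A B (wedgeOne k β φ) =
      wedgeOne k (β ∘L A + Complex.I • (β ∘L B)) (complexPullback k A B φ) := by
  refine complexPullback_alternatize A B _ _ fun u => ?_
  ext v
  simp [mul_assoc, add_mul]

theorem complexPullback_compContinuousLinearMap {U' W' : Type*} [NormedAddCommGroup U']
    [NormedSpace ℝ U'] [NormedAddCommGroup W'] [NormedSpace ℝ W'] {k : ℕ} {A B : U →L[ℝ] W}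
    {A' B' : U' →L[ℝ] W'} {L : W →L[ℝ] W'} {L' : U →L[ℝ] U'} (hA : L ∘L A = A' ∘L L')
    (hB : L ∘L B = B' ∘L L') (α : W' [⋀^Fin k]→L[ℝ] ℂ) :
    complexPullback k A B (α.compContinuousLinearMap L) =
      (complexPullback k A' B' α).compContinuousLinearMap L' := by
  ext v
  simp only [complexPullback_apply_bool, ContinuousAlternatingMap.compContinuousLinearMap_apply]
  refine Finset.sum_congr rfl fun b _ => ?_
  congr 2
  funext j
  have h1 := DFunLike.congr_fun hA (v j)
  have h2 := DFunLike.congr_fun hB (v j)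
  simp only [ContinuousLinearMap.comp_apply] at h1 h2
  simp only [Function.comp_apply]
  split_ifs
  exacts [h2, h1]

theorem continuous_complexPullback (k : ℕ) (A B : U →L[ℝ] W) :
    Continuous (complexPullback k A B) := by
  refine AddMonoidHomClass.continuous_of_bound (complexPullback k A B)
    (∑ _b : Fin k → Bool, (max ‖A‖ ‖B‖) ^ k) fun α => ?_
  refine ContinuousAlternatingMap.opNorm_le_bound _ (by positivity) fun v => ?_
  rw [complexPullback_apply_bool, Finset.sum_mul, Finset.sum_mul]
  refine norm_sum_le_of_le _ fun b _ => ?_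
  have h1 : ‖∏ j, if b j then Complex.I else 1‖ = 1 := by
    rw [norm_prod]
    refine Finset.prod_eq_one fun j _ => ?_
    split_ifs <;> simp
  rw [norm_mul, h1, one_mul]
  refine (α.le_opNorm _).trans ?_
  rw [mul_comm _ ‖α‖, mul_assoc]
  refine mul_le_mul_of_nonneg_left ?_ (norm_nonneg _)
  have h2 : (max ‖A‖ ‖B‖) ^ k * ∏ j, ‖v j‖ = ∏ j, max ‖A‖ ‖B‖ * ‖v j‖ := by
    simp [Finset.prod_mul_distrib]
  rw [h2]
  refine Finset.prod_le_prod (fun _ _ => norm_nonneg _) fun j _ => ?_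
  split_ifs
  · exact (B.le_opNorm _).trans (by gcongr; exact le_max_right _ _)
  · exact (A.le_opNorm _).trans (by gcongr; exact le_max_left _ _)

/-- The Leibniz rule `d(fγ) = df ∧ γ + f dγ`. -/
theorem extDeriv_smul_function {k : ℕ} {f : W → ℂ} {f' : W →L[ℝ] ℂ} {γ : W → W [⋀^Fin k]→L[ℝ] ℂ}
    {x : W} (hf : HasFDerivAt f f' x) (hγ : DifferentiableAt ℝ γ x) :
    extDeriv (fun y => f y • γ y) x = wedgeOne k f' (γ x) + f x • extDeriv γ x := by
  have h : fderiv ℝ (fun y => f y • γ y) x = _ := (hf.smul hγ.hasFDerivAt).fderiv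
  rw [extDeriv, extDeriv]
  ext v
  rw [h]
  simp [wedgeOne, ContinuousAlternatingMap.alternatizeUncurryFin_apply, Finset.mul_sum,
    add_comm]

theorem wedgeOne_smul {k : ℕ} (c : ℂ) (β : W →L[ℝ] ℂ) (φ : W [⋀^Fin k]→L[ℝ] ℂ) :
    wedgeOne k (c • β) φ = c • wedgeOne k β φ := by
  ext v
  simp [wedgeOne, ContinuousAlternatingMap.alternatizeUncurryFin_apply, Finset.mul_sum,
    mul_left_comm, mul_assoc]

theorem wedgeOne_sub {k : ℕ} (β β' : W →L[ℝ] ℂ) (φ : W [⋀^Fin k]→L[ℝ] ℂ) :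
    wedgeOne k (β - β') φ = wedgeOne k β φ - wedgeOne k β' φ := by
  ext v
  simp [wedgeOne, ContinuousAlternatingMap.alternatizeUncurryFin_apply, sub_mul, smul_sub]

theorem wedgeOne_zero {k : ℕ} (φ : W [⋀^Fin k]→L[ℝ] ℂ) :
    wedgeOne k (0 : W →L[ℝ] ℂ) φ = 0 := by
  ext v
  simp [wedgeOne, ContinuousAlternatingMap.alternatizeUncurryFin_apply]

theorem extDeriv_comp_fst {k : ℕ} {γ : W → W [⋀^Fin k]→L[ℝ] ℂ} {w : W × U}
    (hγ : DifferentiableAt ℝ γ w.1) :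
    extDeriv (fun z : W × U => (γ z.1).compContinuousLinearMap (ContinuousLinearMap.fst ℝ W U)) w =
      (extDeriv γ w.1).compContinuousLinearMap (ContinuousLinearMap.fst ℝ W U) := by
  have h := extDeriv_pullback (f := (Prod.fst : W × U → W)) (x := w) hγ
    (contDiffAt_fst (n := 2)) (by simp)
  simpa only [fderiv_fst] using h

end Algebra

section ZeroType
variable {V : Type*} [NormedAddCommGroup V] [NormedSpace ℂ V]

/-- Conjugate-linearity in several variables at once. -/
theorem FormZeroQ.apply_ite {k : ℕ} (α : FormZeroQ V k) (v : Fin k → V) (S : Finset (Fin k)) :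
    α.1 (fun j => if j ∈ S then Complex.I • v j else v j) = (-Complex.I) ^ S.card * α.1 v := by
  classical
  induction S using Finset.induction_on with
  | empty => simp
  | insert i S hi ih =>
    have h : (fun j => if j ∈ insert i S then Complex.I • v j else v j) =
        Function.update (fun j => if j ∈ S then Complex.I • v j else v j) i
          (Complex.I • (fun j => if j ∈ S then Complex.I • v j else v j) i) := by
      funext j
      by_cases hj : j = i
      · subst hj; simp [hi]
      · simp [hj]
    rw [h, α.2, ih, Finset.card_insert_of_notMem hi]
    ring

/-- `projZeroQ` is the identity on forms of type `(0,k)`. -/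
theorem projZeroQ_coe {k : ℕ} (α : FormZeroQ V k) : projZeroQ V k α.1 = α := by
  apply Subtype.ext
  ext v
  refine (complexPullbackForm_apply α.1 _ _ v).trans ?_
  have h : ∀ S : Finset (Fin k), Complex.I ^ S.card * α.1 (fun j => if j ∈ S then
      ((1/2 : ℝ) • mulI V) (v j) else ((1/2 : ℝ) • ContinuousLinearMap.id ℝ V) (v j)) =
      (1/2) ^ k * α.1 v := by
    intro S
    have h1 : (fun j => if j ∈ S then
        ((1/2 : ℝ) • mulI V) (v j) else ((1/2 : ℝ) • ContinuousLinearMap.id ℝ V) (v j)) =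
        fun j => (1/2 : ℝ) • (fun j => if j ∈ S then Complex.I • v j else v j) j := by
      funext j
      split_ifs <;> simp [mulI, *]
    have h2 := α.1.toContinuousMultilinearMap.map_smul_univ (fun _ => (1/2 : ℝ))
      (fun j => if j ∈ S then Complex.I • v j else v j)
    rw [h1]
    refine (congrArg (Complex.I ^ S.card * ·) h2).trans ?_
    change Complex.I ^ S.card * (_ • α.1 _) = _
    rw [FormZeroQ.apply_ite]
    have h3 : Complex.I ^ S.card * (-Complex.I) ^ S.card = 1 := by
      rw [← mul_pow]; simp
    simp only [Finset.prod_const, Finset.card_univ, Fintype.card_fin, Complex.real_smul]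
    push_cast
    linear_combination (1/2) ^ k * α.1 v * h3
  rw [Finset.sum_congr rfl fun S _ => h S]
  simp

theorem projZeroQ_val {k : ℕ} (α : V [⋀^Fin k]→L[ℝ] ℂ) :
    (projZeroQ V k α).1 = complexPullback k ((1/2 : ℝ) • ContinuousLinearMap.id ℝ V)
      ((1/2 : ℝ) • mulI V) α := rfl

theorem contDiff_projZeroQ (k : ℕ) {n : WithTop ℕ∞} :
    ContDiff ℝ n fun α : V [⋀^Fin k]→L[ℝ] ℂ => (projZeroQ V k α).1 :=
  (⟨((complexPullback k ((1/2 : ℝ) • ContinuousLinearMap.id ℝ V)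
      ((1/2 : ℝ) • mulI V)).restrictScalars ℝ), continuous_complexPullback k _ _⟩ :
    (V [⋀^Fin k]→L[ℝ] ℂ) →L[ℝ] (V [⋀^Fin k]→L[ℝ] ℂ)).contDiff

/-- The `(0,1)`-part of a `ℂ`-linear form is zero. -/
theorem comp_projZeroQ_eq_zero {β : V →L[ℝ] ℂ} (hβ : ∀ v, β (Complex.I • v) = Complex.I * β v) :
    β ∘L ((1/2 : ℝ) • ContinuousLinearMap.id ℝ V) + Complex.I • (β ∘L ((1/2 : ℝ) • mulI V)) =
      0 := by
  ext v
  have h1 : β ((1/2 : ℝ) • v) = (1/2 : ℝ) • β v := β.map_smul _ _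
  have h2 : β ((1/2 : ℝ) • (Complex.I • v)) = (1/2 : ℝ) • β (Complex.I • v) := β.map_smul _ _
  change β ((1/2 : ℝ) • v) + Complex.I • β ((1/2 : ℝ) • (Complex.I • v)) = 0
  rw [h1, h2, hβ]
  simp only [Complex.real_smul, smul_eq_mul]
  linear_combination (1/2 : ℝ) * β v * Complex.I_mul_I

/-- The exterior product with a `(1,0)`-form has no component of type `(0,k+1)`. -/
theorem projZeroQ_wedgeOne {k : ℕ} {β : V →L[ℝ] ℂ}
    (hβ : ∀ v, β (Complex.I • v) = Complex.I * β v) (φ : V [⋀^Fin k]→L[ℝ] ℂ) :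
    projZeroQ V (k + 1) (wedgeOne k β φ) = 0 := by
  apply Subtype.ext
  rw [projZeroQ_val, complexPullback_wedgeOne, comp_projZeroQ_eq_zero hβ, wedgeOne_zero]
  rfl

/-- The pull-back by a `ℂ`-linear map preserves types. -/
theorem projZeroQ_compContinuousLinearMap {k : ℕ} {L : V →L[ℝ] V}
    (hL : ∀ v, L (Complex.I • v) = Complex.I • L v) (α : V [⋀^Fin k]→L[ℝ] ℂ) :
    (projZeroQ V k (α.compContinuousLinearMap L)).1 =
      (projZeroQ V k α).1.compContinuousLinearMap L := by
  refine complexPullback_compContinuousLinearMap ?_ ?_ α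
  · ext v; simp
  · ext v; simp [mulI, hL]

/-- The component of type `(0,k+1)` of `dγ` depends only on the component of type `(0,k)` of `γ`. -/
theorem projZeroQ_extDeriv {k : ℕ} {γ : V → V [⋀^Fin k]→L[ℝ] ℂ} {x : V}
    (hγ : DifferentiableAt ℝ γ x) :
    projZeroQ V (k + 1) (extDeriv (fun y => (projZeroQ V k (γ y)).1) x) =
      projZeroQ V (k + 1) (extDeriv γ x) := by
  let P : (V [⋀^Fin k]→L[ℝ] ℂ) →L[ℝ] (V [⋀^Fin k]→L[ℝ] ℂ) :=
    ⟨((complexPullback k ((1/2 : ℝ) • ContinuousLinearMap.id ℝ V)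
      ((1/2 : ℝ) • mulI V)).restrictScalars ℝ), continuous_complexPullback k _ _⟩
  have hPP : ∀ α, P (P α) = P α := fun α => congrArg Subtype.val (projZeroQ_coe (projZeroQ V k α))
  have hd : fderiv ℝ (fun y => (projZeroQ V k (γ y)).1) x = P ∘L fderiv ℝ γ x :=
    (P.hasFDerivAt.comp x hγ.hasFDerivAt).fderiv
  let g : V →L[ℝ] V [⋀^Fin k]→L[ℝ] ℂ :=
    P ∘L fderiv ℝ γ x ∘L ((1/2 : ℝ) • ContinuousLinearMap.id ℝ V) +
      Complex.I • (P ∘L fderiv ℝ γ x ∘L ((1/2 : ℝ) • mulI V))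
  apply Subtype.ext
  rw [projZeroQ_val, projZeroQ_val, extDeriv, extDeriv, hd,
    complexPullback_alternatize _ _ _ g fun u => ?_,
    complexPullback_alternatize _ _ _ g fun u => rfl]
  -- By `complexPullback_alternatize` both sides involve only `P` of the values of `fderiv ℝ γ x`.
  have h1 := hPP (fderiv ℝ γ x (((1/2 : ℝ) • ContinuousLinearMap.id ℝ V) u))
  have h2 := hPP (fderiv ℝ γ x (((1/2 : ℝ) • mulI V) u))
  exact congrArg₂ (· + Complex.I • ·) h1.symm h2.symm

/-- `∂̄² = 0` on an open subset of a complex vector space. -/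
theorem projZeroQ_extDeriv_projZeroQ_extDeriv {k : ℕ} {γ : V → V [⋀^Fin k]→L[ℝ] ℂ} {x : V}
    (hγ : ContDiffAt ℝ ∞ γ x) :
    projZeroQ V (k + 2) (extDeriv (fun y => (projZeroQ V (k + 1) (extDeriv γ y)).1) x) = 0 := by
  have hd : DifferentiableAt ℝ (extDeriv γ) x :=
    (contDiffAt_extDeriv hγ).differentiableAt (by simp)
  rw [projZeroQ_extDeriv hd, extDeriv_extDeriv_apply hγ (by simpa using two_le_infty), map_zero]

end ZeroType

/-! ### Forms in different charts -/
section Forms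
variable {W : Type*} [NormedAddCommGroup W] [NormedSpace ℝ W]
  {M : Type*} [TopologicalSpace M] [ChartedSpace W M] {k : ℕ}

/-- As `T_x M` is identified with `W` by the preferred chart at `x`, the differential of the inverse
of a chart is that of a transition map. -/
theorem mfderiv_chartAt_symm [IsManifold 𝓘(ℝ, W) 1 M] (p : M) {y : W}
    (hy : y ∈ (chartAt W p).target) :
    (mfderiv 𝓘(ℝ, W) 𝓘(ℝ, W) (chartAt W p).symm y : W →L[ℝ] W) =
      fderiv ℝ (chartAt W ((chartAt W p).symm y) ∘ (chartAt W p).symm) y := by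
  refine (mdifferentiableAt_atlas_symm (chart_mem_atlas W p) hy).mfderiv.trans ?_
  change fderivWithin ℝ (chartAt W ((chartAt W p).symm y) ∘ (chartAt W p).symm) (range id) y = _
  rw [range_id, fderivWithin_univ]

theorem contDiffAt_transition [IsManifold 𝓘(ℝ, W) ∞ M] {p x : M} {y : W}
    (hy : y ∈ (chartAt W p).target) (hx : (chartAt W p).symm y ∈ (chartAt W x).source) :
    ContDiffAt ℝ ∞ (chartAt W x ∘ (chartAt W p).symm) y := by
  have h1 : ContMDiffAt 𝓘(ℝ, W) 𝓘(ℝ, W) ∞ (chartAt W p).symm y :=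
    (contMDiffOn_chart_symm (I := 𝓘(ℝ, W)) (x := p)).contMDiffAt
      ((chartAt W p).open_target.mem_nhds hy)
  have h2 : ContMDiffAt 𝓘(ℝ, W) 𝓘(ℝ, W) ∞ (chartAt W x) ((chartAt W p).symm y) :=
    (contMDiffOn_chart (I := 𝓘(ℝ, W)) (x := x)).contMDiffAt
      ((chartAt W x).open_source.mem_nhds hx)
  exact contMDiffAt_iff_contDiffAt.1 (h2.comp y h1)

/-- The expressions of a form in two charts are related by the pull-back by the transition map. -/
theorem chartRep_change [IsManifold 𝓘(ℝ, W) ∞ M] (α : M → W [⋀^Fin k]→L[ℝ] ℂ) {p x : M} {y : W}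
    (hy : y ∈ (chartAt W p).target) (hx : (chartAt W p).symm y ∈ (chartAt W x).source) :
    chartRep α p y = (chartRep α x ((chartAt W x ∘ (chartAt W p).symm) y)).compContinuousLinearMap
      (fderiv ℝ (chartAt W x ∘ (chartAt W p).symm) y) := by
  have : IsManifold 𝓘(ℝ, W) 1 M := .of_le (n := ∞) (by simp)
  set f := chartAt W x ∘ (chartAt W p).symm with hf
  have hfd : MDifferentiableAt 𝓘(ℝ, W) 𝓘(ℝ, W) f y :=
    ((contDiffAt_transition hy hx).differentiableAt (by simp)).mdifferentiableAt
  have hl : (chartAt W x).symm (f y) = (chartAt W p).symm y := (chartAt W x).left_inv hx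
  have hs : MDifferentiableAt 𝓘(ℝ, W) 𝓘(ℝ, W) (chartAt W x).symm (f y) :=
    mdifferentiableAt_atlas_symm (chart_mem_atlas W x) ((chartAt W x).map_source hx)
  have hev : (chartAt W p).symm =ᶠ[𝓝 y] (chartAt W x).symm ∘ f := by
    filter_upwards [((chartAt W p).symm.isOpen_inter_preimage (chartAt W x).open_source).mem_nhds
      ⟨hy, hx⟩] with u hu
    exact ((chartAt W x).left_inv hu.2).symm
  have hD : (mfderiv 𝓘(ℝ, W) 𝓘(ℝ, W) (chartAt W p).symm y : W →L[ℝ] W) =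
      (mfderiv 𝓘(ℝ, W) 𝓘(ℝ, W) (chartAt W x).symm (f y) : W →L[ℝ] W) ∘L fderiv ℝ f y := by
    refine hev.mfderiv_eq.trans ((mfderiv_comp y hs hfd).trans ?_)
    exact congrArg (ContinuousLinearMap.comp _) mfderiv_eq_fderiv
  unfold chartRep
  rw [hD, hl]
  rfl

/-- The exterior derivative may be computed in any chart. -/
theorem chartRep_extD [IsManifold 𝓘(ℝ, W) ∞ M] {α : M → W [⋀^Fin k]→L[ℝ] ℂ} {p : M} {y : W}
    (hy : y ∈ (chartAt W p).target)
    (hα : DifferentiableAt ℝ (chartRep α ((chartAt W p).symm y))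
      (chartAt W ((chartAt W p).symm y) ((chartAt W p).symm y))) :
    chartRep (extD α) p y = extDeriv (chartRep α p) y := by
  have : IsManifold 𝓘(ℝ, W) 1 M := .of_le (n := ∞) (by simp)
  set x := (chartAt W p).symm y with hx
  have hxs : (chartAt W p).symm y ∈ (chartAt W x).source := mem_chart_source W x
  have hev : chartRep α p =ᶠ[𝓝 y] fun u =>
      (chartRep α x ((chartAt W x ∘ (chartAt W p).symm) u)).compContinuousLinearMap
        (fderiv ℝ (chartAt W x ∘ (chartAt W p).symm) u) := by
    filter_upwards [((chartAt W p).symm.isOpen_inter_preimage (chartAt W x).open_source).mem_nhds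
      ⟨hy, hxs⟩] with u hu
    exact chartRep_change α hu.1 hu.2
  have hp := extDeriv_pullback (f := chartAt W x ∘ (chartAt W p).symm) hα
    (contDiffAt_transition hy hxs) (by simpa using two_le_infty)
  rw [hev.extDeriv_eq]
  refine Eq.trans ?_ hp.symm
  unfold chartRep
  rw [mfderiv_chartAt_symm p hy]
  rfl

theorem chartRep_self [IsManifold 𝓘(ℝ, W) ∞ M] (α : M → W [⋀^Fin k]→L[ℝ] ℂ) (p : M) :
    chartRep α p (chartAt W p p) = α p := by
  have : IsManifold 𝓘(ℝ, W) 1 M := .of_le (n := ∞) (by simp)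
  have hl := (chartAt W p).left_inv (mem_chart_source W p)
  have hid : (chartAt W p ∘ (chartAt W p).symm) =ᶠ[𝓝 (chartAt W p p)] id :=
    Filter.eventuallyEq_of_mem ((chartAt W p).open_target.mem_nhds (mem_chart_target W p))
      fun u hu => (chartAt W p).right_inv hu
  unfold chartRep
  rw [mfderiv_chartAt_symm p (mem_chart_target W p), hl, hid.fderiv_eq, fderiv_id]
  rfl

end Forms

/-! ### Powers of a line -/
section LinePower
variable {L : Type*} [NormedAddCommGroup L] [InnerProductSpace ℂ L]

theorem dualVec_self {s : L} (hs : s ≠ 0) : dualVec s s = 1 := by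
  have h : (‖s‖ : ℂ) ≠ 0 := by simpa using hs
  simp [dualVec, inner_self_eq_norm_sq_to_K, h]

theorem dualVec_smul (c : ℂ) (s : L) : dualVec (c • s) = c⁻¹ • dualVec s := by
  by_cases hc : c = 0
  · simp [hc, dualVec]
  ext v
  have h : (starRingEnd ℂ) c * c = (‖c‖ : ℂ) ^ 2 := by
    rw [mul_comm, Complex.mul_conj, Complex.normSq_eq_norm_sq]; simp
  have hn : (‖c‖ : ℂ) ≠ 0 := by simpa using hc
  simp only [dualVec, norm_smul, LinearMap.smul_apply, ContinuousLinearMap.coe_coe,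
    innerSL_apply_apply, inner_smul_left, smul_eq_mul]
  push_cast
  rw [mul_pow, mul_inv, ← h]
  have hc' : (starRingEnd ℂ) c ≠ 0 := by simpa using hc
  field_simp

theorem pairPow_ofNat_tprod {n : ℕ} (s : L) (v : Fin n → L) :
    pairPow (Int.ofNat n) s (PiTensorProduct.tprod ℂ v) = ∏ i, dualVec s (v i) := by
  refine (PiTensorProduct.lift.tprod (R := ℂ) (φ := (MultilinearMap.mkPiAlgebra ℂ (Fin n)
    ℂ).compLinearMap fun _ => dualVec s) v).trans ?_
  simp

theorem pairPow_negSucc_tprod {n : ℕ} (s : L) (v : Fin (n + 1) → Module.Dual ℂ L) :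
    pairPow (Int.negSucc n) s (PiTensorProduct.tprod ℂ v) = ∏ i, v i s := by
  refine (PiTensorProduct.lift.tprod (R := ℂ) (φ := (MultilinearMap.mkPiAlgebra ℂ (Fin (n + 1))
    ℂ).compLinearMap fun _ => Module.Dual.eval ℂ L s) v).trans ?_
  simp

theorem pairPow_smul (m : ℤ) (c : ℂ) (s : L) :
    pairPow m (c • s) = c ^ (-m) • pairPow m s := by
  cases m with
  | ofNat n =>
    refine PiTensorProduct.ext ?_
    ext v
    refine (pairPow_ofNat_tprod (c • s) v).trans
      (Eq.trans ?_ (congrArg (c ^ (-(Int.ofNat n)) * ·) (pairPow_ofNat_tprod s v).symm))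
    simp [dualVec_smul, Finset.prod_mul_distrib]
  | negSucc n =>
    refine PiTensorProduct.ext ?_
    ext v
    refine (pairPow_negSucc_tprod (c • s) v).trans
      (Eq.trans ?_ (congrArg (c ^ (-(Int.negSucc n)) * ·) (pairPow_negSucc_tprod s v).symm))
    simp only [map_smul, smul_eq_mul, Finset.prod_mul_distrib, Int.neg_negSucc]
    simp [← zpow_natCast]

theorem pairPow_vecPow (m : ℤ) {s : L} (hs : s ≠ 0) : pairPow m s (vecPow m s) = 1 := by
  cases m with
  | ofNat n => exact (pairPow_ofNat_tprod s _).trans (by simp [dualVec_self hs])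
  | negSucc n => exact (pairPow_negSucc_tprod s _).trans (by simp [dualVec_self hs])

/-- If `s` spans `L`, then `s^m` spans `L^m`. -/
theorem pairPow_smul_vecPow (m : ℤ) {s : L} (hs : s ≠ 0) (hL : ∀ v : L, ∃ c : ℂ, v = c • s)
    (t : LinePow L m) : pairPow m s t • vecPow m s = t := by
  have hv : ∀ v : L, dualVec s v • s = v := by
    intro v
    obtain ⟨c, rfl⟩ := hL v
    rw [map_smul, dualVec_self hs, smul_eq_mul, mul_one]
  have hl : ∀ l : Module.Dual ℂ L, l s • dualVec s = l := by
    intro l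
    ext v
    conv_rhs => rw [← hv v]
    simp [mul_comm]
  suffices h : (LinearMap.toSpanSingleton ℂ (LinePow L m) (vecPow m s)) ∘ₗ pairPow m s =
      LinearMap.id from LinearMap.congr_fun h t
  cases m with
  | ofNat n =>
    refine PiTensorProduct.ext ?_
    ext v
    have h := (PiTensorProduct.tprod ℂ).map_smul_univ (fun i => dualVec s (v i)) fun _ : Fin n => s
    simp only [hv] at h
    exact (congrArg (· • vecPow (Int.ofNat n) s) (pairPow_ofNat_tprod s v)).trans h.symm
  | negSucc n =>
    refine PiTensorProduct.ext ?_
    ext v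
    have h := (PiTensorProduct.tprod ℂ).map_smul_univ (fun i => v i s)
      fun _ : Fin (n + 1) => dualVec s
    simp only [hl] at h
    exact (congrArg (· • vecPow (Int.negSucc n) s) (pairPow_negSucc_tprod s v)).trans h.symm

variable {V : Type*} [NormedAddCommGroup V] [NormedSpace ℂ V] {m : ℤ} {q : ℕ}

theorem contract_smul (c : ℂ) (s : L) (t : FormZeroQ V q ⊗[ℂ] LinePow L m) :
    contract V m q (c • s) t = c ^ (-m) • contract V m q s t := by
  simp only [contract, pairPow_smul, LinearMap.lTensor_smul, LinearMap.comp_smul,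
    LinearMap.smul_apply]

theorem contract_tmul_vecPow {s : L} (hs : s ≠ 0) (φ : FormZeroQ V q) :
    contract V m q s (φ ⊗ₜ[ℂ] vecPow m s) = φ := by
  simp [contract, pairPow_vecPow m hs]

theorem contract_tmul {s : L} (hs : s ≠ 0) (hL : ∀ v : L, ∃ c : ℂ, v = c • s)
    (t : FormZeroQ V q ⊗[ℂ] LinePow L m) :
    contract V m q s t ⊗ₜ[ℂ] vecPow m s = t := by
  induction t using TensorProduct.induction_on with
  | zero => simp
  | tmul φ l =>
    simp only [contract, LinearMap.comp_apply, LinearMap.lTensor_tmul, LinearEquiv.coe_coe,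
      TensorProduct.rid_tmul]
    rw [TensorProduct.smul_tmul, pairPow_smul_vecPow m hs hL]
  | add a b ha hb => rw [map_add, TensorProduct.add_tmul, ha, hb]

end LinePower

/-! ### The Dolbeault complex in holomorphic charts and frames -/
section Base
variable {V : Type*} [NormedAddCommGroup V] [NormedSpace ℂ V]
  {B : Type*} [TopologicalSpace B] [ChartedSpace V B]

theorem contDiffAt_complex_transition [IsManifold 𝓘(ℂ, V) ω B] {e e' : OpenPartialHomeomorph B V}
    (he : e ∈ atlas V B) (he' : e' ∈ atlas V B) {y : V}
    (hy : y ∈ e.target) (hx : e.symm y ∈ e'.source) :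
    ContDiffAt ℂ ω (e' ∘ e.symm) y := by
  have h1 : ContMDiffAt 𝓘(ℂ, V) 𝓘(ℂ, V) ω e.symm y :=
    (contMDiffOn_symm_of_mem_maximalAtlas
      (IsManifold.subset_maximalAtlas (I := 𝓘(ℂ, V)) (n := ω) he)).contMDiffAt
      (e.open_target.mem_nhds hy)
  have h2 : ContMDiffAt 𝓘(ℂ, V) 𝓘(ℂ, V) ω e' (e.symm y) :=
    (contMDiffOn_of_mem_maximalAtlas
      (IsManifold.subset_maximalAtlas (I := 𝓘(ℂ, V)) (n := ω) he')).contMDiffAt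
      (e'.open_source.mem_nhds hx)
  exact contMDiffAt_iff_contDiffAt.1 (h2.comp y h1)

variable (V B) in
/-- The smooth manifold that underlies the complex manifold `B`. -/
theorem isManifold_real [IsManifold 𝓘(ℂ, V) ω B] : IsManifold 𝓘(ℝ, V) ∞ B := by
  refine isManifold_of_contDiffOn _ _ _ fun e e' he he' => ?_
  simp only [modelWithCornersSelf_coe, modelWithCornersSelf_coe_symm, Function.id_comp,
    Function.comp_id, preimage_id, range_id, inter_univ]
  rintro y ⟨hy, hx⟩
  exact (((contDiffAt_complex_transition he he' hy hx).of_le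
    le_top).restrict_scalars ℝ).contDiffWithinAt

/-- The real differential of a holomorphic map is `ℂ`-linear. -/
theorem fderiv_real_smul_I {F : Type*} [NormedAddCommGroup F] [NormedSpace ℂ F] {f : V → F} {y : V}
    (hf : DifferentiableAt ℂ f y) (v : V) :
    fderiv ℝ f y (Complex.I • v) = Complex.I • fderiv ℝ f y v := by
  rw [hf.fderiv_restrictScalars ℝ]
  exact (fderiv ℂ f y).map_smul _ _

/-- The coordinate changes of `B` are holomorphic. -/
theorem mfderiv_chartAt_symm_smul_I [IsManifold 𝓘(ℂ, V) ω B] (p : B) {y : V}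
    (hy : y ∈ (chartAt V p).target) {D : V →L[ℝ] V}
    (hD : D = mfderiv 𝓘(ℝ, V) 𝓘(ℝ, V) (chartAt V p).symm y) (v : V) :
    D (Complex.I • v) = Complex.I • D v := by
  have : IsManifold 𝓘(ℝ, V) ∞ B := isManifold_real V B
  have : IsManifold 𝓘(ℝ, V) 1 B := .of_le (n := ∞) (by simp)
  rw [hD.trans (mfderiv_chartAt_symm p hy)]
  exact fderiv_real_smul_I ((contDiffAt_complex_transition (chart_mem_atlas V p)
    (chart_mem_atlas V _) hy (mem_chart_source V _)).differentiableAt (by simp)) v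

end Base

section LineBundle
variable {V : Type*} [NormedAddCommGroup V] [NormedSpace ℂ V]
  {B : Type*} [TopologicalSpace B] [ChartedSpace V B]
  {E : B → Type*} [∀ x, NormedAddCommGroup (E x)] [∀ x, InnerProductSpace ℂ (E x)]
  [TopologicalSpace (TotalSpace ℂ E)] [FiberBundle ℂ E] [VectorBundle ℂ ℂ E]

variable (E) in
/-- The holomorphic transition function `g` with `σ₀ = g σ₁`, for the local holomorphic frames
`σ₀` and `σ₁` at `x₀` and `x₁`. -/
def frameChange (x₀ x₁ x : B) : ℂ :=
  ((trivializationAt ℂ E x₀).coordChangeL ℂ (trivializationAt ℂ E x₁) x : ℂ →L[ℂ] ℂ) 1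

theorem exists_eq_smul_localFrame {x₀ x : B} (hx : x ∈ (trivializationAt ℂ E x₀).baseSet)
    (v : E x) : ∃ c : ℂ, v = c • localFrame E x₀ x :=
  ⟨(trivializationAt ℂ E x₀ ⟨x, v⟩).2, by
    rw [← symm_eq_smul hx]
    exact ((trivializationAt ℂ E x₀).symm_apply_apply_mk hx v).symm⟩

theorem localFrame_change {x₀ x₁ x : B} (h0 : x ∈ (trivializationAt ℂ E x₀).baseSet)
    (h1 : x ∈ (trivializationAt ℂ E x₁).baseSet) :
    localFrame E x₀ x = frameChange E x₀ x₁ x • localFrame E x₁ x := by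
  rw [← symm_eq_smul h1]
  refine Eq.trans ?_ (congrArg ((trivializationAt ℂ E x₁).symm x)
    ((trivializationAt ℂ E x₀).coordChangeL_apply (R := ℂ)
      (trivializationAt ℂ E x₁) ⟨h0, h1⟩ 1).symm)
  exact ((trivializationAt ℂ E x₁).symm_apply_apply_mk h1 _).symm

theorem frameChange_ne_zero {x₀ x₁ x : B} (h0 : x ∈ (trivializationAt ℂ E x₀).baseSet)
    (h1 : x ∈ (trivializationAt ℂ E x₁).baseSet) : frameChange E x₀ x₁ x ≠ 0 := by
  intro h
  refine localFrame_ne_zero h0 ?_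
  rw [localFrame_change h0 h1, h, zero_smul]

theorem differentiableAt_frameChange [IsManifold 𝓘(ℂ, V) ω B]
    [ContMDiffVectorBundle ω ℂ E 𝓘(ℂ, V)] {x₀ x₁ p : B} {y : V} (hy : y ∈ (chartAt V p).target)
    (h0 : (chartAt V p).symm y ∈ (trivializationAt ℂ E x₀).baseSet)
    (h1 : (chartAt V p).symm y ∈ (trivializationAt ℂ E x₁).baseSet) :
    DifferentiableAt ℂ (fun u => frameChange E x₀ x₁ ((chartAt V p).symm u)) y := by
  have hsymm : ContMDiffAt 𝓘(ℂ, V) 𝓘(ℂ, V) ω (chartAt V p).symm y :=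
    (contMDiffOn_chart_symm (I := 𝓘(ℂ, V)) (x := p)).contMDiffAt
      ((chartAt V p).open_target.mem_nhds hy)
  have h := (contMDiffAt_coordChangeL (IB := 𝓘(ℂ, V)) (n := ω)
    (e := trivializationAt ℂ E x₀) (e' := trivializationAt ℂ E x₁) h0 h1).comp y hsymm
  exact ((contMDiffAt_iff_contDiffAt.1 h).differentiableAt (by simp)).clm_apply
    (differentiableAt_const _)

variable {m : ℤ} {q : ℕ}

theorem coeff_change (η : BundleForm V E m q) {x₀ x₁ x : B}
    (h0 : x ∈ (trivializationAt ℂ E x₀).baseSet) (h1 : x ∈ (trivializationAt ℂ E x₁).baseSet) :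
    coeff V m q x₀ η x = frameChange E x₀ x₁ x ^ (-m) • coeff V m q x₁ η x := by
  rw [coeff, localFrame_change h0 h1, contract_smul]
  rfl

theorem target_inter_preimage_baseSet_mem_nhds (x₀ : B) {y : V} (hy : y ∈ (chartAt V x₀).target)
    (h0 : (chartAt V x₀).symm y ∈ (trivializationAt ℂ E x₀).baseSet) :
    (chartAt V x₀).target ∩ (chartAt V x₀).symm ⁻¹' (trivializationAt ℂ E x₀).baseSet ∈ 𝓝 y :=
  ((chartAt V x₀).isOpen_inter_preimage_symm
    (trivializationAt ℂ E x₀).open_baseSet).mem_nhds ⟨hy, h0⟩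

theorem contDiffAt_coeff {η : BundleForm V E m q} (hη : η ∈ dolbeaultForms V E m q) (x₀ : B) {y : V}
    (hy : y ∈ (chartAt V x₀).target)
    (h0 : (chartAt V x₀).symm y ∈ (trivializationAt ℂ E x₀).baseSet) :
    ContDiffAt ℝ ∞ (chartRep (coeff V m q x₀ η) x₀) y :=
  (hη x₀).contDiffAt (target_inter_preimage_baseSet_mem_nhds x₀ hy h0)

/-- Near `x`, the coefficient with respect to the frame at `x₀`, in the chart at `x`, is the
product of a nowhere zero holomorphic function and the coefficient with respect to the frame at
`x`. -/
theorem chartRep_coeff_change (η : BundleForm V E m q) {x₀ x : B}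
    (h0 : x ∈ (trivializationAt ℂ E x₀).baseSet) :
    chartRep (coeff V m q x₀ η) x =ᶠ[𝓝 (chartAt V x x)] fun u =>
      frameChange E x₀ x ((chartAt V x).symm u) ^ (-m) • chartRep (coeff V m q x η) x u := by
  have hx := (chartAt V x).left_inv (mem_chart_source V x)
  filter_upwards [((chartAt V x).isOpen_inter_preimage_symm
    ((trivializationAt ℂ E x₀).open_baseSet.inter
      (trivializationAt ℂ E x).open_baseSet)).mem_nhds ⟨mem_chart_target V x, by
        rw [mem_preimage, hx]; exact ⟨h0, mem_baseSet_trivializationAt ℂ E x⟩⟩] with u hu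
  unfold chartRep
  rw [coeff_change η hu.2.1 hu.2.2]
  rfl

variable [IsManifold 𝓘(ℂ, V) ω B] [ContMDiffVectorBundle ω ℂ E 𝓘(ℂ, V)]

theorem differentiableAt_frameChange_zpow (m : ℤ) {x₀ x : B}
    (h0 : x ∈ (trivializationAt ℂ E x₀).baseSet) :
    DifferentiableAt ℂ (fun u => frameChange E x₀ x ((chartAt V x).symm u) ^ m)
      (chartAt V x x) := by
  have hx := (chartAt V x).left_inv (mem_chart_source V x)
  have h1 := mem_baseSet_trivializationAt ℂ E x
  refine (differentiableAt_frameChange (mem_chart_target V x) ?_ ?_).zpow (Or.inl ?_)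
  · rw [hx]; exact h0
  · rw [hx]; exact h1
  · rw [hx]; exact frameChange_ne_zero h0 h1

theorem differentiableAt_chartRep_coeff {η : BundleForm V E m q} (hη : η ∈ dolbeaultForms V E m q)
    {x₀ x : B} (h0 : x ∈ (trivializationAt ℂ E x₀).baseSet) :
    DifferentiableAt ℝ (chartRep (coeff V m q x₀ η) x) (chartAt V x x) := by
  refine DifferentiableAt.congr_of_eventuallyEq ?_ (chartRep_coeff_change η h0)
  exact ((differentiableAt_frameChange_zpow (V := V) (-m) h0).restrictScalars ℝ).smul
    (differentiableAt_coeff V ⟨η, hη⟩ x)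

/-- The definition of `∂̄` does not depend on the holomorphic frame. -/
theorem coeff_dbar {η : BundleForm V E m q} (hη : η ∈ dolbeaultForms V E m q) {x₀ x : B}
    (h0 : x ∈ (trivializationAt ℂ E x₀).baseSet) :
    coeff V m (q + 1) x₀ (dbar V m q η) x =
      projZeroQ V (q + 1) (extD (coeff V m q x₀ η) x) := by
  have h1 := mem_baseSet_trivializationAt ℂ E x
  have hx := (chartAt V x).left_inv (mem_chart_source V x)
  have hg := differentiableAt_frameChange_zpow (V := V) (-m) h0
  have hd : extD (coeff V m q x₀ η) x =
      wedgeOne q (fderiv ℝ (fun u => frameChange E x₀ x ((chartAt V x).symm u) ^ (-m))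
        (chartAt V x x)) (chartRep (coeff V m q x η) x (chartAt V x x)) +
      frameChange E x₀ x x ^ (-m) • extD (coeff V m q x η) x := by
    rw [extD, (chartRep_coeff_change η h0).extDeriv_eq,
      extDeriv_smul_function (hg.restrictScalars ℝ).hasFDerivAt
        (differentiableAt_coeff V ⟨η, hη⟩ x), hx]
    rfl
  -- The differential of the holomorphic factor `g^{-m}` is of type `(1,0)`.
  rw [hd, map_add, map_smul, projZeroQ_wedgeOne (fderiv_real_smul_I hg), zero_add, coeff, dbar,
    localFrame_change h0 h1, contract_smul, contract_tmul_vecPow (localFrame_ne_zero h1)]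

/-- The definition of `∂̄` does not depend on the holomorphic chart. -/
theorem chartRep_coeff_dbar {η : BundleForm V E m q} (hη : η ∈ dolbeaultForms V E m q) {x₀ : B}
    {y : V} (hy : y ∈ (chartAt V x₀).target)
    (h0 : (chartAt V x₀).symm y ∈ (trivializationAt ℂ E x₀).baseSet) :
    chartRep (coeff V m (q + 1) x₀ (dbar V m q η)) x₀ y =
      projZeroQ V (q + 1) (extDeriv (chartRep (coeff V m q x₀ η) x₀) y) := by
  have : IsManifold 𝓘(ℝ, V) ∞ B := isManifold_real V B
  rw [← chartRep_extD hy (differentiableAt_chartRep_coeff hη h0)]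
  unfold chartRep
  rw [coeff_dbar hη h0]
  exact (projZeroQ_compContinuousLinearMap (mfderiv_chartAt_symm_smul_I x₀ hy rfl) _).symm

theorem dbar_mem_dolbeaultForms {η : BundleForm V E m q} (hη : η ∈ dolbeaultForms V E m q) :
    dbar V m q η ∈ dolbeaultForms V E m (q + 1) := by
  rintro x₀ y ⟨hy, h0⟩
  refine ContDiffAt.contDiffWithinAt ?_
  refine ContDiffAt.congr_of_eventuallyEq ?_
    (Filter.eventuallyEq_of_mem (target_inter_preimage_baseSet_mem_nhds x₀ hy h0)
      fun u hu => chartRep_coeff_dbar hη hu.1 hu.2)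
  exact (contDiff_projZeroQ (q + 1)).contDiffAt.comp y
    (contDiffAt_extDeriv (contDiffAt_coeff hη x₀ hy h0))

theorem dbar_dbar {η : BundleForm V E m q} (hη : η ∈ dolbeaultForms V E m q) :
    dbar V m (q + 1) (dbar V m q η) = 0 := by
  funext x
  have hy := mem_chart_target V x
  have h0 : (chartAt V x).symm (chartAt V x x) ∈ (trivializationAt ℂ E x).baseSet := by
    rw [(chartAt V x).left_inv (mem_chart_source V x)]
    exact mem_baseSet_trivializationAt ℂ E x
  have hev := Filter.eventuallyEq_of_mem (target_inter_preimage_baseSet_mem_nhds x hy h0)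
      fun u hu => chartRep_coeff_dbar hη hu.1 hu.2
  rw [dbar, extD, hev.extDeriv_eq,
    projZeroQ_extDeriv_projZeroQ_extDeriv (contDiffAt_coeff hη x hy h0), TensorProduct.zero_tmul]
  rfl

end LineBundle

/-! ### The circle bundle in the charts -/
section Circle
variable {V : Type*} [NormedAddCommGroup V] [NormedSpace ℂ V]
  {B : Type*} [TopologicalSpace B] [ChartedSpace V B]
  {E : B → Type*} [∀ x, NormedAddCommGroup (E x)] [∀ x, InnerProductSpace ℂ (E x)]
  [TopologicalSpace (TotalSpace ℂ E)] [FiberBundle ℂ E] [VectorBundle ℂ ℂ E]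

theorem fiberCoord_circleAct {x₀ : B} (t : ℝ) (p : CircleBundle E)
    (hx : rho p ∈ (trivializationAt ℂ E x₀).baseSet) :
    fiberCoord x₀ (circleAct t p) = Complex.exp (t * Complex.I) * fiberCoord x₀ p := by
  have h1 : vec (circleAct t p) = fiberCoord x₀ (circleAct t p) • localFrame E x₀ (rho p) :=
    vec_eq (circleAct t p) hx
  have h2 : vec (circleAct t p) = Complex.exp (t * Complex.I) • vec p := rfl
  rw [h2, vec_eq p hx, smul_smul] at h1
  exact (smul_left_injective ℂ (localFrame_ne_zero hx) h1).symm

/-- The circle action is transitive on the fibres of `SE`. -/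
theorem exists_eq_circleAct {p p' : CircleBundle E} (h : rho p = rho p') :
    ∃ t : ℝ, p' = circleAct t p := by
  have hp := mem_base p
  have hp' : rho p' ∈ (trivializationAt ℂ E (rho p)).baseSet := h ▸ hp
  have hne := fiberCoord_ne_zero p hp
  refine ⟨Complex.arg (fiberCoord (rho p) p' / fiberCoord (rho p) p),
    eq_of_coords (x₀ := rho p) hp' h.symm ?_⟩
  have hn : ‖fiberCoord (rho p) p' / fiberCoord (rho p) p‖ = 1 := by
    rw [norm_div, norm_fiberCoord p hp, norm_fiberCoord p' hp', ← h]
    exact div_self (inv_ne_zero (norm_ne_zero_iff.2 (localFrame_ne_zero hp)))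
  have he := Complex.norm_mul_exp_arg_mul_I (fiberCoord (rho p) p' / fiberCoord (rho p) p)
  rw [hn, Complex.ofReal_one, one_mul] at he
  rw [fiberCoord_circleAct _ p hp, he, div_mul_cancel₀ _ hne]

theorem circleAct_circleAct (s t : ℝ) (p : CircleBundle E) :
    circleAct s (circleAct t p) = circleAct (s + t) p := by
  refine eq_of_coords (x₀ := rho p) (mem_base p) rfl ?_
  rw [fiberCoord_circleAct (x₀ := rho p) s (circleAct t p) (mem_base p),
    fiberCoord_circleAct _ _ (mem_base p), fiberCoord_circleAct _ _ (mem_base p), ← mul_assoc,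
    ← Complex.exp_add]
  congr 2
  push_cast; ring

theorem circleAct_zero (p : CircleBundle E) : circleAct 0 p = p := by
  refine eq_of_coords (x₀ := rho p) (mem_base p) rfl ?_
  rw [fiberCoord_circleAct _ _ (mem_base p)]
  simp

/-- In the chart at `p₀` the action of `e^{it}` is the translation by `t` of the last coordinate. -/
theorem circleAct_circleInv (t : ℝ) (p₀ : CircleBundle E) {w : V × ℝ}
    (hw : (chartAt V (rho p₀)).symm w.1 ∈ (trivializationAt ℂ E (rho p₀)).baseSet) :
    circleAct t (circleInv V p₀ w) = circleInv V p₀ (w.1, w.2 + t) := by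
  have hr := rho_circleInv p₀ hw
  have hr' : rho (circleInv V p₀ (w.1, w.2 + t)) = _ := rho_circleInv p₀ hw
  refine eq_of_coords (x₀ := rho p₀) (hr ▸ hw) (hr.trans hr'.symm) ?_
  rw [fiberCoord_circleAct _ _ (hr ▸ hw), fiberCoord_circleInv p₀ hw,
    fiberCoord_circleInv p₀ (w := (w.1, w.2 + t)) hw]
  push_cast
  rw [add_mul, Complex.exp_add]
  ring

/-- The charts at `p₀` and at `e^{it}p₀` differ by the translation by `t` of the last coordinate. -/
theorem circleInv_circleAct (t : ℝ) (p₀ : CircleBundle E) {w : V × ℝ}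
    (hw : (chartAt V (rho p₀)).symm w.1 ∈ (trivializationAt ℂ E (rho p₀)).baseSet) :
    circleInv V (circleAct t p₀) w = circleInv V p₀ (w.1, w.2 + t) := by
  have hr : rho (circleInv V (circleAct t p₀) w) = _ := rho_circleInv (circleAct t p₀) hw
  have hr' : rho (circleInv V p₀ (w.1, w.2 + t)) = _ := rho_circleInv p₀ hw
  have hn : ‖fiberCoord (rho p₀) (circleAct t p₀)‖ = ‖fiberCoord (rho p₀) p₀‖ := by
    rw [fiberCoord_circleAct _ _ (mem_base p₀), norm_mul, Complex.norm_exp_ofReal_mul_I, one_mul]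
  have h1 := fiberCoord_circleInv (circleAct t p₀) hw
  change fiberCoord (rho p₀) _ = ((‖fiberCoord (rho p₀) (circleAct t p₀)‖ *
    ‖localFrame E (rho p₀) ((chartAt V (rho p₀)).symm w.1)‖)⁻¹ : ℝ) *
      (fiberCoord (rho p₀) (circleAct t p₀) * _) at h1
  refine eq_of_coords (x₀ := rho p₀) (hr ▸ hw) (hr.trans hr'.symm) ?_
  rw [h1, hn, fiberCoord_circleAct _ _ (mem_base p₀),
    fiberCoord_circleInv p₀ (w := (w.1, w.2 + t)) hw]
  push_cast
  rw [add_mul, Complex.exp_add]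
  ring

variable (V) in
theorem chart_symm_mem_base (p : CircleBundle E) :
    (chartAt V (rho p)).symm (chartAt V (rho p) (rho p)) ∈
      (trivializationAt ℂ E (rho p)).baseSet := by
  rw [(chartAt V (rho p)).left_inv (mem_chart_source V (rho p))]
  exact mem_base p

/-- The coordinates of `p` in the chart at `p`. -/
theorem circleInv_self (p : CircleBundle E) :
    circleInv V p (chartAt V (rho p) (rho p), 0) = p := by
  have hb := chart_symm_mem_base V p
  have hl := (chartAt V (rho p)).left_inv (mem_chart_source V (rho p))
  have hr : rho (circleInv V p (chartAt V (rho p) (rho p), 0)) = _ := rho_circleInv p hb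
  refine eq_of_coords (x₀ := rho p) (hr ▸ hb) (hr.trans hl) ?_
  have hn : ‖localFrame E (rho p) ((chartAt V (rho p)).symm (chartAt V (rho p) (rho p)))‖ =
      ‖localFrame E (rho p) (rho p)‖ := congrArg (fun x => ‖localFrame E (rho p) x‖) hl
  rw [fiberCoord_circleInv p hb, hn, norm_fiberCoord p (mem_base p),
    inv_mul_cancel₀ (norm_ne_zero_iff.2 (localFrame_ne_zero (mem_base p)))]
  simp

variable (V E) in
/-- The function `log |σ|²`, for the holomorphic frame `σ` at `x₀`, in the chart at `x₀`. -/
def logNormSq (x₀ : B) (y : V) : ℝ :=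
  Real.log (‖localFrame E x₀ ((chartAt V x₀).symm y)‖ ^ 2)

/-- On `SE` the coefficient `f` in `p = fσ` has absolute value `|σ|⁻¹`. -/
theorem fiberCoord_circleInv_eq_exp (p₀ : CircleBundle E) {w : V × ℝ}
    (hw : (chartAt V (rho p₀)).symm w.1 ∈ (trivializationAt ℂ E (rho p₀)).baseSet) :
    fiberCoord (rho p₀) (circleInv V p₀ w) =
      ((‖fiberCoord (rho p₀) p₀‖⁻¹ : ℝ) * fiberCoord (rho p₀) p₀) *
        Complex.exp (-(1 / 2 : ℂ) * (logNormSq V E (rho p₀) w.1 : ℝ) + w.2 * Complex.I) := by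
  have hpos := norm_pos_iff.2 (localFrame_ne_zero hw)
  have h : ‖localFrame E (rho p₀) ((chartAt V (rho p₀)).symm w.1)‖⁻¹ =
      Real.exp (-(1 / 2) * logNormSq V E (rho p₀) w.1) := by
    rw [logNormSq, Real.log_pow, ← Real.exp_log hpos, ← Real.exp_neg, Real.log_exp]
    congr 1
    push_cast; ring
  rw [fiberCoord_circleInv p₀ hw, mul_inv, h, Complex.exp_add]
  push_cast
  ring

variable [SmoothHermitian V E]

theorem mem_circle_target {p : CircleBundle E} {w : V × ℝ} :
    w ∈ (chartAt (V × ℝ) p).target ↔ w.1 ∈ (chartAt V (rho p)).target ∧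
      (chartAt V (rho p)).symm w.1 ∈ (trivializationAt ℂ E (rho p)).baseSet ∧
      w.2 ∈ Ioo (-Real.pi) Real.pi := Iff.rfl

theorem circle_chart_symm (p : CircleBundle E) (w : V × ℝ) :
    (chartAt (V × ℝ) p).symm w = circleInv V p w := rfl

theorem circle_chart_self (p : CircleBundle E) :
    chartAt (V × ℝ) p p = (chartAt V (rho p) (rho p), 0) := by
  change (chartAt V (rho p) (rho p),
    Complex.arg (fiberCoord (rho p) p / fiberCoord (rho p) p)) = _
  rw [div_self (fiberCoord_ne_zero p (mem_base p)), Complex.arg_one]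

theorem contDiffAt_logNormSq [IsManifold 𝓘(ℂ, V) ω B] (x₀ : B) {y : V}
    (hy : y ∈ (chartAt V x₀).target)
    (h0 : (chartAt V x₀).symm y ∈ (trivializationAt ℂ E x₀).baseSet) :
    ContDiffAt ℝ ∞ (logNormSq V E x₀) y := by
  have : IsManifold 𝓘(ℝ, V) ∞ B := isManifold_real V B
  have h1 : ContMDiffAt 𝓘(ℝ, V) 𝓘(ℝ, V) ∞ (chartAt V x₀).symm y :=
    (contMDiffOn_chart_symm (I := 𝓘(ℝ, V)) (x := x₀)).contMDiffAt
      ((chartAt V x₀).open_target.mem_nhds hy)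
  have h2 := (SmoothHermitian.contMDiffOn_normSq (V := V) (E := E) x₀).contMDiffAt
    ((trivializationAt ℂ E x₀).open_baseSet.mem_nhds h0)
  exact (contMDiffAt_iff_contDiffAt.1 (h2.comp y h1)).log
    (pow_ne_zero 2 (norm_ne_zero_iff.2 (localFrame_ne_zero h0)))

theorem contDiffAt_fiberCoord [IsManifold 𝓘(ℂ, V) ω B] {p : CircleBundle E} {w : V × ℝ}
    (hw : w ∈ (chartAt (V × ℝ) p).target) :
    ContDiffAt ℝ ∞ (fun u => fiberCoord (rho p) (circleInv V p u)) w := by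
  have hw' := mem_circle_target.1 hw
  refine ContDiffAt.congr_of_eventuallyEq ?_ (Filter.eventuallyEq_of_mem
    ((chartAt (V × ℝ) p).open_target.mem_nhds hw) fun u hu => fiberCoord_circleInv_eq_exp p hu.2.1)
  have h1 : ContDiffAt ℝ ∞ (fun u : V × ℝ => (logNormSq V E (rho p) u.1 : ℂ)) w :=
    Complex.ofRealCLM.contDiff.contDiffAt.comp w
      ((contDiffAt_logNormSq (rho p) hw'.1 hw'.2.1).comp w contDiffAt_fst)
  have h2 : ContDiffAt ℝ ∞ (fun u : V × ℝ => (u.2 : ℂ)) w :=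
    Complex.ofRealCLM.contDiff.contDiffAt.comp w contDiffAt_snd
  exact contDiffAt_const.mul (((contDiffAt_const.mul h1).add (h2.mul contDiffAt_const)).cexp)

theorem fiberCoord_circleInv_ne_zero {p : CircleBundle E} {w : V × ℝ}
    (hw : w ∈ (chartAt (V × ℝ) p).target) : fiberCoord (rho p) (circleInv V p w) ≠ 0 :=
  fiberCoord_ne_zero _ (by rw [rho_circleInv p hw.2.1]; exact hw.2.1)

theorem contDiffAt_fiberCoord_zpow [IsManifold 𝓘(ℂ, V) ω B] (m : ℤ) {p : CircleBundle E}
    {w : V × ℝ} (hw : w ∈ (chartAt (V × ℝ) p).target) :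
    ContDiffAt ℝ ∞ (fun u => fiberCoord (rho p) (circleInv V p u) ^ m) w := by
  cases m with
  | ofNat n => simpa using (contDiffAt_fiberCoord hw).pow n
  | negSucc n =>
    exact (((contDiffAt_fiberCoord hw).pow (n + 1)).inv
      (pow_ne_zero _ (fiberCoord_circleInv_ne_zero hw))).congr_of_eventuallyEq
      (Filter.Eventually.of_forall fun u => zpow_negSucc _ n)

/-! ### The circle action and the connection form -/

/-- In the charts at `p` and at `e^{it}p` the action of `e^{it}` is the identity. -/
theorem mfderiv_circleAct (t : ℝ) (p : CircleBundle E) :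
    mfderiv 𝓘(ℝ, V × ℝ) 𝓘(ℝ, V × ℝ) (circleAct t : CircleBundle E → CircleBundle E) p =
      ContinuousLinearMap.id ℝ (V × ℝ) := by
  have hact : ∀ w ∈ (chartAt (V × ℝ) p).target, circleAct t ((chartAt (V × ℝ) p).symm w) =
      (chartAt (V × ℝ) (circleAct t p)).symm w := fun w hw => by
    rw [circle_chart_symm, circle_chart_symm, circleAct_circleInv t p hw.2.1,
      circleInv_circleAct t p hw.2.1]
  have hp := mem_chart_target (V × ℝ) p
  refine HasMFDerivAt.mfderiv (f' := ContinuousLinearMap.id ℝ (V × ℝ)) ⟨?_, ?_⟩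
  · have h1 : circleAct t =ᶠ[𝓝 p]
        (chartAt (V × ℝ) (circleAct t p)).symm ∘ chartAt (V × ℝ) p := by
      filter_upwards [(chartAt (V × ℝ) p).open_source.mem_nhds (mem_chart_source _ p)] with u hu
      rw [Function.comp_apply, ← hact _ ((chartAt (V × ℝ) p).map_source hu),
        (chartAt (V × ℝ) p).left_inv hu]
    refine ContinuousAt.congr ?_ h1.symm
    exact ((chartAt (V × ℝ) (circleAct t p)).continuousAt_symm hp).comp
      ((chartAt (V × ℝ) p).continuousAt (mem_chart_source _ p))
  · apply HasFDerivAt.hasFDerivWithinAt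
    refine (hasFDerivAt_id _).congr_of_eventuallyEq ?_
    have : (chartAt (V × ℝ) p).target ∈ 𝓝 (extChartAt 𝓘(ℝ, V × ℝ) p p) := by
      simpa using (chartAt (V × ℝ) p).open_target.mem_nhds hp
    filter_upwards [this] with w hw
    simp only [writtenInExtChartAt, mfld_simps]
    rw [hact w hw]
    exact (chartAt (V × ℝ) (circleAct t p)).right_inv hw

/-- In the chart at `p` the generator `𝒯` is `∂/∂t`. -/
theorem vecT_eq (p : CircleBundle E) : vecT V p = (0, 1) := by
  set c := chartAt V (rho p) (rho p)
  have hT : ∀ t ∈ Ioo (-Real.pi) Real.pi,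
      (c, t) ∈ (chartAt (V × ℝ) (circleAct 0 p)).target := fun t ht =>
    ⟨mem_chart_target V (rho p), chart_symm_mem_base V p, ht⟩
  have hact : ∀ t : ℝ, circleAct t p = (chartAt (V × ℝ) (circleAct 0 p)).symm (c, t) := by
    intro t
    conv_lhs => rw [← circleInv_self (V := V) p, circleAct_circleInv t p (chart_symm_mem_base V p)]
    rw [circle_chart_symm, circleInv_circleAct 0 p (chart_symm_mem_base V p)]
    simp [c]
  have h0 : (0 : ℝ) ∈ Ioo (-Real.pi) Real.pi := ⟨by linarith [Real.pi_pos], Real.pi_pos⟩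
  have h : mfderiv 𝓘(ℝ, ℝ) 𝓘(ℝ, V × ℝ) (fun t : ℝ => circleAct t p) 0 =
      ContinuousLinearMap.inr ℝ V ℝ := by
    refine HasMFDerivAt.mfderiv (f' := ContinuousLinearMap.inr ℝ V ℝ) ⟨?_, ?_⟩
    · have hc : ContinuousAt (fun t : ℝ => (c, t)) 0 := by fun_prop
      exact (((chartAt (V × ℝ) (circleAct 0 p)).continuousAt_symm (hT 0 h0)).comp
        (f := fun t : ℝ => (c, t)) hc).congr (Filter.Eventually.of_forall fun t => (hact t).symm)
    · apply HasFDerivAt.hasFDerivWithinAt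
      refine (hasFDerivAt_prodMk_right c (0 : ℝ)).congr_of_eventuallyEq ?_
      filter_upwards [isOpen_Ioo.mem_nhds h0] with t ht
      change chartAt (V × ℝ) (circleAct 0 p) (circleAct t p) = (c, t)
      rw [hact t]
      exact (chartAt (V × ℝ) (circleAct 0 p)).right_inv (hT t ht)
  exact (congrArg (fun L : ℝ →L[ℝ] V × ℝ => L 1) h).trans (by simp)

variable [IsManifold 𝓘(ℂ, V) ω B]

theorem mfderiv_log_eq (x₀ : B) :
    mfderiv 𝓘(ℝ, V) 𝓘(ℝ, ℝ) (fun x => Real.log (‖localFrame E x₀ x‖ ^ 2)) x₀ =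
      fderiv ℝ (logNormSq V E x₀) (chartAt V x₀ x₀) := by
  have hl := (chartAt V x₀).left_inv (mem_chart_source V x₀)
  have hb := mem_baseSet_trivializationAt ℂ E x₀
  have hd := (contDiffAt_logNormSq (E := E) x₀ (mem_chart_target V x₀)
    (by rw [hl]; exact hb)).differentiableAt (by simp)
  have hc := ((SmoothHermitian.contMDiffOn_normSq (V := V) (E := E) x₀).continuousOn.continuousAt
    ((trivializationAt ℂ E x₀).open_baseSet.mem_nhds hb)).log
    (pow_ne_zero 2 (norm_ne_zero_iff.2 (localFrame_ne_zero hb)))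
  exact HasMFDerivAt.mfderiv (f' := fderiv ℝ (logNormSq V E x₀) (chartAt V x₀ x₀))
    ⟨hc, hd.hasFDerivAt.hasFDerivWithinAt⟩

theorem chernForm_apply (x₀ : B) (v : V) :
    chernForm (E := E) V x₀ x₀ v =
      (1 / 2 : ℂ) * (fderiv ℝ (logNormSq V E x₀) (chartAt V x₀ x₀) v -
        Complex.I * fderiv ℝ (logNormSq V E x₀) (chartAt V x₀ x₀) (Complex.I • v)) := by
  unfold chernForm
  rw [mfderiv_log_eq]
  rfl

/-- `∂ log |σ|²` is of type `(1,0)`. -/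
theorem chernForm_smul_I (x₀ : B) (v : V) :
    chernForm (E := E) V x₀ x₀ (Complex.I • v) = Complex.I * chernForm (E := E) V x₀ x₀ v := by
  have h : Complex.I • Complex.I • v = -v := by rw [smul_smul, Complex.I_mul_I, neg_one_smul]
  rw [chernForm_apply, chernForm_apply, h, map_neg]
  push_cast
  linear_combination (1 / 2 : ℂ) * ((fderiv ℝ (logNormSq V E x₀) (chartAt V x₀ x₀)
    (Complex.I • v) : ℝ) : ℂ) * Complex.I_mul_I

/-- The differential `df = f (-d log |σ|² / 2 + i dt)` of the fibre coordinate, at `p`. -/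
theorem hasFDerivAt_fiberCoord_exp (p : CircleBundle E) :
    HasFDerivAt (fun u => fiberCoord (rho p) (circleInv V p u))
      (fiberCoord (rho p) p • (-(1 / 2 : ℂ) • (Complex.ofRealCLM ∘L
        fderiv ℝ (logNormSq V E (rho p)) (chartAt V (rho p) (rho p)) ∘L
          ContinuousLinearMap.fst ℝ V ℝ) +
        Complex.I • (Complex.ofRealCLM ∘L ContinuousLinearMap.snd ℝ V ℝ)))
      (chartAt (V × ℝ) p p) := by
  have hw := mem_chart_target (V × ℝ) p
  have hev := Filter.eventuallyEq_of_mem ((chartAt (V × ℝ) p).open_target.mem_nhds hw)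
    fun u hu => fiberCoord_circleInv_eq_exp (V := V) p (w := u) hu.2.1
  rw [circle_chart_self] at hev hw ⊢
  have hself := hev.self_of_nhds
  beta_reduce at hself
  rw [circleInv_self] at hself
  refine HasFDerivAt.congr_of_eventuallyEq ?_ hev
  have h1 : HasFDerivAt (logNormSq V E (rho p))
      (fderiv ℝ (logNormSq V E (rho p)) (chartAt V (rho p) (rho p)))
      ((chartAt V (rho p) (rho p), (0 : ℝ)) : V × ℝ).1 :=
    ((contDiffAt_logNormSq (rho p) hw.1 hw.2.1).differentiableAt (by simp)).hasFDerivAt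
  have h2 := Complex.ofRealCLM.hasFDerivAt.comp (chartAt V (rho p) (rho p), (0 : ℝ))
    (h1.comp _ hasFDerivAt_fst)
  have h3 := Complex.ofRealCLM.hasFDerivAt.comp (chartAt V (rho p) (rho p), (0 : ℝ))
    (hasFDerivAt_snd (𝕜 := ℝ) (E := V) (F := ℝ))
  refine (((h2.const_mul (-(1 / 2 : ℂ))).add (h3.mul_const Complex.I)).cexp.const_mul
    (((‖fiberCoord (rho p) p‖⁻¹ : ℝ) : ℂ) * fiberCoord (rho p) p)).congr_fderiv ?_
  rw [smul_smul]
  exact congrArg (· • _) hself.symm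

/-- The connection form in the chart at `p`. -/
theorem theta_apply (p : CircleBundle E) (v : V × ℝ) :
    theta V p v = v.2 - (1 / 2) *
      fderiv ℝ (logNormSq V E (rho p)) (chartAt V (rho p) (rho p)) (Complex.I • v.1) := by
  have hm : mfderiv 𝓘(ℝ, V × ℝ) 𝓘(ℝ, ℂ) (fiberCoord (rho p) : CircleBundle E → ℂ) p = _ :=
    HasMFDerivAt.mfderiv ⟨(continuousOn_fiberCoord (rho p)).continuousAt
      (((trivializationAt ℂ E (rho p)).open_baseSet.preimage continuous_rho).mem_nhds
        (mem_base p)), (hasFDerivAt_fiberCoord_exp (V := V) p).hasFDerivWithinAt⟩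
  have hne := fiberCoord_ne_zero p (mem_base p)
  unfold theta
  rw [hm, dRho_eq]
  dsimp only
  rw [inv_smul_smul₀ hne]
  change (_ + chernForm (E := E) V (rho p) (rho p) v.1 : ℂ).im = _
  rw [chernForm_apply]
  simp [sub_eq_add_neg]

end Circle

section Circle
variable {V : Type*} [NormedAddCommGroup V] [NormedSpace ℂ V]
  {B : Type*} [TopologicalSpace B] [ChartedSpace V B]
  {E : B → Type*} [∀ x, NormedAddCommGroup (E x)] [∀ x, InnerProductSpace ℂ (E x)]
  [TopologicalSpace (TotalSpace ℂ E)] [FiberBundle ℂ E] [VectorBundle ℂ ℂ E]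
  [SmoothHermitian V E] [IsManifold 𝓘(ℂ, V) ω B]

theorem theta_vecT (p : CircleBundle E) : theta V p (vecT V p) = 1 := by
  rw [theta_apply, vecT_eq]
  simp

/-- The differential of the fibre coordinate `f` in terms of the connection form:
`df = f (iθ - ρ^* ∂ log |σ|²)`. -/
theorem hasFDerivAt_fiberCoord (p : CircleBundle E) :
    HasFDerivAt (fun u => fiberCoord (rho p) (circleInv V p u))
      (fiberCoord (rho p) p • (Complex.I • (Complex.ofRealCLM ∘L theta V p) -
        chernForm (E := E) V (rho p) (rho p) ∘L ContinuousLinearMap.fst ℝ V ℝ))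
      (chartAt (V × ℝ) p p) := by
  refine (hasFDerivAt_fiberCoord_exp (V := V) p).congr_fderiv
    (congrArg (fiberCoord (rho p) p • ·) (ContinuousLinearMap.ext fun v => ?_))
  change -(1 / 2 : ℂ) * ((fderiv ℝ (logNormSq V E (rho p)) _ v.1 : ℝ) : ℂ) +
    Complex.I * ((v.2 : ℝ) : ℂ) =
    Complex.I * ((theta V p v : ℝ) : ℂ) - chernForm (E := E) V (rho p) (rho p) v.1
  rw [theta_apply, chernForm_apply]
  push_cast
  ring

theorem hasFDerivAt_fiberCoord_zpow (m : ℤ) (p : CircleBundle E) :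
    HasFDerivAt (fun u => fiberCoord (rho p) (circleInv V p u) ^ m)
      (((m : ℂ) * fiberCoord (rho p) p ^ m) • (Complex.I • (Complex.ofRealCLM ∘L theta V p) -
        chernForm (E := E) V (rho p) (rho p) ∘L ContinuousLinearMap.fst ℝ V ℝ))
      (chartAt (V × ℝ) p p) := by
  have hne := fiberCoord_ne_zero p (mem_base p)
  have hself : fiberCoord (rho p) (circleInv V p (chartAt (V × ℝ) p p)) = fiberCoord (rho p) p := by
    rw [circle_chart_self, circleInv_self]
  have h := (hasDerivAt_zpow m _ (Or.inl (hself ▸ hne))).comp_hasFDerivAt _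
    (hasFDerivAt_fiberCoord (V := V) p)
  refine h.congr_fderiv ?_
  rw [hself, smul_smul, mul_assoc, zpow_sub_one₀ hne, inv_mul_cancel_right₀ hne]

/-! ### Forms on `V̄` and `K̄` -/

theorem fst_comp_hLift (p : CircleBundle E) (a : V) : (hLift V p a).1 = a := by
  simp [hLift, vecT_eq]

theorem theta_hLift (p : CircleBundle E) (a : V) : theta V p (hLift V p a) = 0 := by
  simp [hLift, theta_vecT]

theorem opJ_apply (p : CircleBundle E) (v : V × ℝ) :
    opJ V p v = hLift V p (Complex.I • v.1) := by
  simp [opJ, dRho_eq, mulI]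

/-- A form pulled back from `B` is restricted to `V̄` by taking its component of type `(0,k)`. -/
theorem restrictVbar_comp_fst (p : CircleBundle E) {k : ℕ} (α : V [⋀^Fin k]→L[ℝ] ℂ) :
    restrictVbar V p (α.compContinuousLinearMap (ContinuousLinearMap.fst ℝ V ℝ)) =
      (projZeroQ V k α).1.compContinuousLinearMap (ContinuousLinearMap.fst ℝ V ℝ) := by
  refine complexPullback_compContinuousLinearMap ?_ ?_ α
  · refine ContinuousLinearMap.ext fun v => ?_
    simp [vecT_eq]
  · refine ContinuousLinearMap.ext fun v => ?_
    simp [opJ_apply, fst_comp_hLift, mulI]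

/-- `θ` is a form on `V̄` as it stands. -/
theorem restrictVbar_wedgeOne_theta (p : CircleBundle E) {k : ℕ} (φ : (V × ℝ) [⋀^Fin k]→L[ℝ] ℂ) :
    restrictVbar V p (wedgeOne k (Complex.ofRealCLM ∘L theta V p) φ) =
      wedgeOne k (Complex.ofRealCLM ∘L theta V p) (restrictVbar V p φ) := by
  refine (complexPullback_wedgeOne _ _ _ φ).trans ?_
  refine congrArg (fun β => wedgeOne k β _) (ContinuousLinearMap.ext fun v => ?_)
  have h1 : theta V p (((1 / 2 : ℝ) • (ContinuousLinearMap.id ℝ (V × ℝ) +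
      (theta V p).smulRight (vecT V p))) v) = theta V p v := by
    simp [theta_vecT]; ring
  have h2 : theta V p (((1 / 2 : ℝ) • opJ V p) v) = 0 := by
    simp [opJ_apply, theta_hLift]
  exact (congrArg₂ (fun x y : ℝ => (x : ℂ) + Complex.I • (y : ℂ)) h1 h2).trans (by simp)

/-- The pull-back of a `(1,0)`-form vanishes on `V̄`. -/
theorem restrictVbar_wedgeOne_comp_fst (p : CircleBundle E) {k : ℕ} {β : V →L[ℝ] ℂ}
    (hβ : ∀ v, β (Complex.I • v) = Complex.I * β v) (φ : (V × ℝ) [⋀^Fin k]→L[ℝ] ℂ) :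
    restrictVbar V p (wedgeOne k (β ∘L ContinuousLinearMap.fst ℝ V ℝ) φ) = 0 := by
  refine (complexPullback_wedgeOne _ _ _ φ).trans ?_
  have h : ∀ v : V × ℝ, β ((((1 / 2 : ℝ) • (ContinuousLinearMap.id ℝ (V × ℝ) +
      (theta V p).smulRight (vecT V p))) v).1) + Complex.I • β ((((1 / 2 : ℝ) • opJ V p) v).1) =
      0 := by
    intro v
    refine Eq.trans ?_ (DFunLike.congr_fun (comp_projZeroQ_eq_zero hβ) v.1)
    simp [vecT_eq, opJ_apply, fst_comp_hLift, mulI]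
  refine Eq.trans (congrArg (fun β => wedgeOne k β _) (ContinuousLinearMap.ext (g := 0) h)) ?_
  exact wedgeOne_zero _

/-- The pull-back of a form of type `(0,q)` on `B` is a section of `Λ^q K̄*`. -/
theorem comp_fst_mem_FormKbar (p : CircleBundle E) {q : ℕ} (α : FormZeroQ V q) :
    α.1.compContinuousLinearMap (ContinuousLinearMap.fst ℝ V ℝ) ∈ FormKbar V p q := by
  refine ⟨fun v j hj => ?_, fun v j _ => ?_⟩
  · refine α.1.map_coord_zero j ?_
    simp [hj, vecT_eq]
  · have h : (ContinuousLinearMap.fst ℝ V ℝ) ∘ Function.update v j (opJ V p (v j)) =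
        Function.update (ContinuousLinearMap.fst ℝ V ℝ ∘ v) j
          (Complex.I • (ContinuousLinearMap.fst ℝ V ℝ ∘ v) j) := by
      rw [Function.comp_update, opJ_apply]
      simp [fst_comp_hLift]
    change α.1 (_ ∘ _) = _ * α.1 (_ ∘ _)
    exact (congrArg α.1 h).trans (α.2 _ j)

/-- The elements of `Λ^q K̄*` depend only on the projections to `B` of their arguments. -/
theorem FormKbar.eq_comp_fst {p : CircleBundle E} {q : ℕ} {φ : (V × ℝ) [⋀^Fin q]→L[ℝ] ℂ}
    (hφ : φ ∈ FormKbar V p q) : (φ.compContinuousLinearMap (ContinuousLinearMap.inl ℝ V ℝ)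
      ).compContinuousLinearMap (ContinuousLinearMap.fst ℝ V ℝ) = φ := by
  classical
  ext v
  suffices h : ∀ S : Finset (Fin q), φ (fun j => if j ∈ S then ((v j).1, 0) else v j) = φ v by
    simpa [Function.comp_def] using h Finset.univ
  intro S
  induction S using Finset.induction_on with
  | empty => simp
  | insert i S hi ih =>
    set w : Fin q → V × ℝ := fun j => if j ∈ S then ((v j).1, 0) else v j with hw
    -- `(v_i.1, 0)` differs from `v_i` by a multiple of `𝒯`, which `φ` annihilates.
    have h1 : (fun j => if j ∈ insert i S then ((v j).1, (0 : ℝ)) else v j) =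
        Function.update w i (v i + (-(v i).2) • vecT V p) := by
      funext j
      by_cases hj : j = i
      · subst hj; simp [vecT_eq]
        ext <;> simp
      · simp [hj, hw]
    have h2 : v i = w i := by simp [hw, hi]
    rw [h1, φ.map_update_add, φ.map_update_smul, hφ.1 (Function.update w i (vecT V p)) i (by simp),
      smul_zero, add_zero, h2, Function.update_eq_self, ih]

/-- The form on `B` of which an element of `Λ^q K̄*` is the pull-back is of type `(0,q)`. -/
theorem FormKbar.comp_inl_mem {p : CircleBundle E} {q : ℕ} {φ : (V × ℝ) [⋀^Fin q]→L[ℝ] ℂ}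
    (hφ : φ ∈ FormKbar V p q) :
    φ.compContinuousLinearMap (ContinuousLinearMap.inl ℝ V ℝ) ∈ FormZeroQ V q := by
  intro a j
  have hfst : ∀ u u' : Fin q → V × ℝ, (∀ i, (u i).1 = (u' i).1) → φ u = φ u' := by
    intro u u' h
    rw [← FormKbar.eq_comp_fst hφ]
    exact congrArg (fun b => φ (fun i => ContinuousLinearMap.inl ℝ V ℝ (b i))) (funext h)
  -- Conjugate-linearity is known for horizontal arguments, so `a i` is lifted to `ker θ`.
  have h := hφ.2 (fun i => hLift V p (a i)) j (theta_hLift p _)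
  rw [opJ_apply, fst_comp_hLift] at h
  refine (hfst _ (Function.update (fun i => hLift V p (a i)) j (hLift V p (Complex.I • a j)))
    fun i => ?_).trans (h.trans (congrArg (-Complex.I * ·) (hfst _ _ fun i => ?_)))
  · by_cases hi : i = j
    · subst hi; simp [fst_comp_hLift]
    · simp [hi, fst_comp_hLift]
  · simp [fst_comp_hLift]

/-! ### The circle action on forms -/
variable {m : ℤ} {q : ℕ}

/-- Since `𝔞_t` is the identity in the charts at `p` and at `e^{it}p`, the pull-back is a
translation. -/
theorem flowPullback_eq (φ : CircleForm V E q) (t : ℝ) (p : CircleBundle E) :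
    flowPullback V q φ t p = φ (circleAct t p) := by
  unfold flowPullback
  rw [mfderiv_circleAct]
  rfl

/-- Integration of `ℒ_𝒯 φ + imφ = 0` along the orbits of the circle action. -/
theorem fourierForms_circleAct {φ : CircleForm V E q} (hφ : φ ∈ fourierForms V E m q) (t : ℝ)
    (p : CircleBundle E) : φ (circleAct t p) = Complex.exp (t * Complex.I) ^ (-m) • φ p := by
  have hg : ∀ s : ℝ, HasDerivAt (fun t => φ (circleAct t p))
      (-(Complex.I * m) • φ (circleAct s p)) s := by
    intro s
    have h := hφ.2.2 (circleAct s p)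
    simp only [flowPullback_eq, circleAct_circleAct] at h
    have h' := HasDerivAt.comp_sub_const s s (by simpa using h)
    simpa using h'
  have he : ∀ s : ℝ, HasDerivAt (fun t : ℝ => Complex.exp (t * (Complex.I * m)))
      (Complex.exp (s * (Complex.I * m)) * (Complex.I * m)) s := fun s => by
    simpa using ((Complex.ofRealCLM.hasDerivAt (x := s)).mul_const (Complex.I * m)).cexp
  -- `e^{imt} φ(e^{it}p)` does not depend on `t`.
  have hc := is_const_of_deriv_eq_zero (f := fun t : ℝ =>
    Complex.exp (t * (Complex.I * m)) • φ (circleAct t p))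
    (fun s => ((he s).smul (hg s)).differentiableAt)
    (fun s => by
      have hd : HasDerivAt
          (fun t : ℝ => Complex.exp (t * (Complex.I * m)) • φ (circleAct t p)) _ s :=
        (he s).smul (hg s)
      rw [hd.deriv, smul_smul]
      exact (add_smul _ _ _).symm.trans (by simp)) t 0
  simp only [Complex.ofReal_zero, zero_mul, Complex.exp_zero, one_smul, circleAct_zero] at hc
  rw [← hc, smul_smul, ← Complex.exp_int_mul, ← Complex.exp_add]
  have h0 : ((-m : ℤ) : ℂ) * (t * Complex.I) + t * (Complex.I * m) = 0 := by
    push_cast; ring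
  rw [h0, Complex.exp_zero, one_smul]

end Circle

/-! ### The map `F_m` -/
section MapF
variable {V : Type*} [NormedAddCommGroup V] [NormedSpace ℂ V]
  {B : Type*} [TopologicalSpace B] [ChartedSpace V B]
  {E : B → Type*} [∀ x, NormedAddCommGroup (E x)] [∀ x, InnerProductSpace ℂ (E x)]
  [TopologicalSpace (TotalSpace ℂ E)] [FiberBundle ℂ E] [VectorBundle ℂ ℂ E]
  [SmoothHermitian V E] {m : ℤ} {q : ℕ}

theorem mapF_apply (η : BundleForm V E m q) (p : CircleBundle E) :
    mapF V E m q η p = (contract V m q (vec p) (η (rho p))).1.compContinuousLinearMap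
      (ContinuousLinearMap.fst ℝ V ℝ) := by
  rw [← dRho_eq V p]
  rfl

/-- `F_m(φ ⊗ σ^m) = f^{-m} ρ^*φ`. -/
theorem mapF_eq_coeff (η : BundleForm V E m q) {x₀ : B} {p : CircleBundle E}
    (hx : rho p ∈ (trivializationAt ℂ E x₀).baseSet) :
    mapF V E m q η p = fiberCoord x₀ p ^ (-m) •
      (coeff V m q x₀ η (rho p)).compContinuousLinearMap (ContinuousLinearMap.fst ℝ V ℝ) := by
  rw [mapF_apply, vec_eq p hx, contract_smul]
  rfl

variable [IsManifold 𝓘(ℂ, V) ω B] [ContMDiffVectorBundle ω ℂ E 𝓘(ℂ, V)]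

/-- The projection `ρ` intertwines the coordinate changes of `SE` and of `B`. -/
theorem fst_comp_mfderiv_chartAt_symm {p : CircleBundle E} {w : V × ℝ}
    (hw : w ∈ (chartAt (V × ℝ) p).target) {D : V × ℝ →L[ℝ] V × ℝ} {D' : V →L[ℝ] V}
    (hD : D = mfderiv 𝓘(ℝ, V × ℝ) 𝓘(ℝ, V × ℝ) (chartAt (V × ℝ) p).symm w)
    (hD' : D' = mfderiv 𝓘(ℝ, V) 𝓘(ℝ, V) (chartAt V (rho p)).symm w.1) :
    ContinuousLinearMap.fst ℝ V ℝ ∘L D = D' ∘L ContinuousLinearMap.fst ℝ V ℝ := by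
  have : IsManifold 𝓘(ℝ, V) ∞ B := isManifold_real V B
  have : IsManifold 𝓘(ℝ, V) 1 B := .of_le (n := ∞) (by simp)
  have : IsManifold 𝓘(ℝ, V × ℝ) 1 (CircleBundle E) := .of_le (n := ∞) (by simp)
  rw [hD.trans (mfderiv_chartAt_symm p hw), hD'.trans (mfderiv_chartAt_symm (rho p) hw.1)]
  have h1 := ((contDiffAt_transition hw (mem_chart_source (V × ℝ)
    ((chartAt (V × ℝ) p).symm w))).differentiableAt (by simp)).hasFDerivAt
  have h2 := ((contDiffAt_transition hw.1 (mem_chart_source V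
    ((chartAt V (rho p)).symm w.1))).differentiableAt (by simp)).hasFDerivAt
  have h3 := (ContinuousLinearMap.fst ℝ V ℝ).hasFDerivAt.comp w h1
  have h4 := h2.comp w (hasFDerivAt_fst (𝕜 := ℝ) (E := V) (F := ℝ))
  refine h3.unique (h4.congr_of_eventuallyEq ?_)
  filter_upwards [(chartAt (V × ℝ) p).open_target.mem_nhds hw] with u hu
  change chartAt V (rho (circleInv V p w)) (rho (circleInv V p u)) =
    chartAt V ((chartAt V (rho p)).symm w.1) ((chartAt V (rho p)).symm u.1)
  rw [rho_circleInv p hw.2.1, rho_circleInv p hu.2.1]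

/-- The expression of `F_m(η)` in the charts of `SE`. -/
theorem chartRep_mapF (η : BundleForm V E m q) {p : CircleBundle E} {w : V × ℝ}
    (hw : w ∈ (chartAt (V × ℝ) p).target) :
    chartRep (mapF V E m q η) p w = fiberCoord (rho p) (circleInv V p w) ^ (-m) •
      (chartRep (coeff V m q (rho p) η) (rho p) w.1).compContinuousLinearMap
        (ContinuousLinearMap.fst ℝ V ℝ) := by
  have hr := rho_circleInv p hw.2.1
  have hb : rho (circleInv V p w) ∈ (trivializationAt ℂ E (rho p)).baseSet := by
    rw [hr]; exact hw.2.1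
  have hF := fst_comp_mfderiv_chartAt_symm hw rfl rfl
  unfold chartRep
  rw [circle_chart_symm, mapF_eq_coeff η hb, hr]
  ext v
  refine congrArg (fun z => fiberCoord (rho p) (circleInv V p w) ^ (-m) *
    coeff V m q (rho p) η ((chartAt V (rho p)).symm w.1) z) (funext fun i => ?_)
  exact DFunLike.congr_fun hF (v i)

theorem mapF_mem_fourierForms {η : BundleForm V E m q} (hη : η ∈ dolbeaultForms V E m q) :
    mapF V E m q η ∈ fourierForms V E m q := by
  refine ⟨fun p w hw => ?_, fun p => ?_, fun p => ?_⟩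
  · refine ContDiffAt.contDiffWithinAt (ContDiffAt.congr_of_eventuallyEq ?_
      (Filter.eventuallyEq_of_mem ((chartAt (V × ℝ) p).open_target.mem_nhds hw)
        fun u hu => chartRep_mapF η hu))
    have h1 := (contDiffAt_coeff hη (rho p) hw.1 hw.2.1).comp w contDiffAt_fst
    exact (contDiffAt_fiberCoord_zpow (-m) hw).smul
      ((contDiff_compContinuousLinearMap (ContinuousLinearMap.fst ℝ V ℝ)).contDiffAt.comp w h1)
  · rw [mapF_apply]
    exact comp_fst_mem_FormKbar p _
  · have h : ∀ t : ℝ, flowPullback V q (mapF V E m q η) t p =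
        Complex.exp (t * Complex.I) ^ (-m) • mapF V E m q η p := fun t => by
      have hb := mem_base p
      rw [flowPullback_eq, mapF_eq_coeff η hb, mapF_eq_coeff (p := circleAct t p) η hb,
        fiberCoord_circleAct t p hb, mul_zpow, smul_smul]
      rfl
    simp only [h]
    have he : HasDerivAt (fun t : ℝ => Complex.exp (t * Complex.I) ^ (-m))
        (-(Complex.I * m)) 0 := by
      have := (((Complex.ofRealCLM.hasDerivAt (x := (0 : ℝ))).mul_const Complex.I).const_mul
        (((-m : ℤ)) : ℂ)).cexp
      simp only [← Complex.exp_int_mul]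
      simpa [mul_comm] using this
    exact he.smul_const (mapF V E m q η p)

theorem exists_norm_eq_one (x : B) : ∃ v : E x, ‖v‖ = 1 := by
  have h := norm_ne_zero_iff.2 (localFrame_ne_zero (mem_baseSet_trivializationAt ℂ E x))
  refine ⟨((‖localFrame E x x‖⁻¹ : ℝ) : ℂ) • localFrame E x x, ?_⟩
  rw [norm_smul, Complex.norm_real, norm_inv, norm_norm, inv_mul_cancel₀ h]

/-- A unit vector `v` of `E_x` spans `E_x`, so that `η(x)` can be recovered from its contraction
with `v^{-m}`. -/
theorem mapF_injective : Function.Injective (mapF V E m q) := by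
  intro η η' h
  funext x
  obtain ⟨v, hv⟩ := exists_norm_eq_one (E := E) x
  have hv0 : v ≠ 0 := by rintro rfl; simp at hv
  have hL : ∀ u : E x, ∃ c : ℂ, u = c • v := by
    have hb := mem_baseSet_trivializationAt ℂ E x
    obtain ⟨a, ha⟩ := exists_eq_smul_localFrame hb v
    have ha0 : a ≠ 0 := by rintro rfl; simp [ha] at hv0
    intro u
    obtain ⟨c, hc⟩ := exists_eq_smul_localFrame hb u
    exact ⟨c * a⁻¹, by rw [ha, smul_smul, inv_mul_cancel_right₀ ha0, hc]⟩
  have h1 := congrFun h ⟨⟨x, v⟩, hv⟩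
  rw [mapF_apply, mapF_apply] at h1
  have h2 : contract V m q v (η x) = contract V m q v (η' x) := by
    apply Subtype.ext
    ext a
    exact DFunLike.congr_fun h1 fun i => (a i, 0)
  rw [← contract_tmul hv0 hL (η x), h2, contract_tmul hv0 hL]

/-- `F_m` is onto: for unit vectors `p` of `E_x`, the form `φ(p)` is the pull-back of a form `α_p`
of type `(0,q)` on `B`, and `α_p ⊗ p^m` depends only on `x`. -/
theorem exists_mapF_eq {φ : CircleForm V E q} (hφ : φ ∈ fourierForms V E m q) :
    ∃ η ∈ dolbeaultForms V E m q, mapF V E m q η = φ := by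
  choose u hu using exists_norm_eq_one (E := E)
  let P : B → CircleBundle E := fun x => ⟨⟨x, u x⟩, hu x⟩
  let α : B → FormZeroQ V q := fun x => ⟨_, FormKbar.comp_inl_mem (hφ.2.1 (P x))⟩
  let η : BundleForm V E m q := fun x => α x ⊗ₜ[ℂ] vecPow m (u x)
  have hu0 : ∀ x, u x ≠ 0 := fun x h => by simpa [h] using hu x
  have hη : mapF V E m q η = φ := by
    funext p
    obtain ⟨t, ht⟩ := exists_eq_circleAct (p := P (rho p)) (p' := p) rfl
    have h1 : mapF V E m q η (circleAct t (P (rho p))) =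
        Complex.exp (t * Complex.I) ^ (-m) • φ (P (rho p)) := by
      have h2 : contract V m q (vec (circleAct t (P (rho p)))) (η (rho p)) =
          Complex.exp (t * Complex.I) ^ (-m) • α (rho p) :=
        (contract_smul _ (u (rho p)) _).trans
          (congrArg _ (contract_tmul_vecPow (hu0 (rho p)) (α (rho p))))
      rw [mapF_apply]
      refine (congrArg (fun a : FormZeroQ V q => a.1.compContinuousLinearMap
        (ContinuousLinearMap.fst ℝ V ℝ)) h2).trans ?_
      exact congrArg (Complex.exp (t * Complex.I) ^ (-m) • ·)
        (FormKbar.eq_comp_fst (hφ.2.1 (P (rho p))))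
    rw [← fourierForms_circleAct hφ, ← ht] at h1
    exact h1
  refine ⟨η, ?_, hη⟩
  -- The coefficient of `η` is smooth: on the slice `t = 0` of a chart of `SE` it is `f^m φ`.
  rintro x₀ y ⟨hy, h0⟩
  have hT : ∀ z : V, z ∈ (chartAt V x₀).target → (chartAt V x₀).symm z ∈
      (trivializationAt ℂ E x₀).baseSet → (z, (0 : ℝ)) ∈ (chartAt (V × ℝ) (P x₀)).target :=
    fun z hz hz0 => ⟨hz, hz0, by simp [Real.pi_pos]⟩
  have hw := hT y hy h0
  refine ContDiffAt.contDiffWithinAt (ContDiffAt.congr_of_eventuallyEq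
    (f := fun z => fiberCoord x₀ (circleInv V (P x₀) (z, 0)) ^ m •
      (chartRep φ (P x₀) (z, 0)).compContinuousLinearMap (ContinuousLinearMap.inl ℝ V ℝ)) ?_ ?_)
  · have hi : ContDiffAt ℝ ∞ (fun z : V => (z, (0 : ℝ))) y := contDiffAt_id.prodMk contDiffAt_const
    have h1 : ContDiffAt ℝ ∞ (chartRep φ (P x₀)) (y, (0 : ℝ)) := (hφ.1 (P x₀)).contDiffAt
      ((chartAt (V × ℝ) (P x₀)).open_target.mem_nhds hw)
    have h2 : ContDiffAt ℝ ∞ (fun z => fiberCoord x₀ (circleInv V (P x₀) z) ^ m) (y, (0 : ℝ)) :=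
      contDiffAt_fiberCoord_zpow m hw
    exact (h2.comp y hi).smul ((contDiff_compContinuousLinearMap
      (ContinuousLinearMap.inl ℝ V ℝ)).contDiffAt.comp y (h1.comp y hi))
  · filter_upwards [target_inter_preimage_baseSet_mem_nhds x₀ hy h0] with z hz
    have hz' := hT z hz.1 hz.2
    have h1 : chartRep φ (P x₀) (z, 0) = fiberCoord x₀ (circleInv V (P x₀) (z, 0)) ^ (-m) •
        (chartRep (coeff V m q x₀ η) x₀ z).compContinuousLinearMap
          (ContinuousLinearMap.fst ℝ V ℝ) := by
      rw [← hη]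
      exact chartRep_mapF η hz'
    have hne : fiberCoord x₀ (circleInv V (P x₀) (z, 0)) ^ m ≠ 0 :=
      zpow_ne_zero m (fiberCoord_circleInv_ne_zero hz')
    rw [h1, zpow_neg]
    exact (smul_inv_smul₀ hne _).symm

theorem bijOn_mapF : BijOn (mapF V E m q) (dolbeaultForms V E m q) (fourierForms V E m q) :=
  ⟨fun _ hη => mapF_mem_fourierForms hη, mapF_injective.injOn, fun _ hφ => exists_mapF_eq hφ⟩

/-- `∂̄_b F_m = F_m ∂̄`: the derivative of the factor `f^{-m}` contributes `-imθ ∧ F_m(η)` to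
`D̄ F_m(η)`, which is cancelled by the term of `∂̄_b` with the Lie derivative. -/
theorem dbarB_mapF {η : BundleForm V E m q} (hη : η ∈ dolbeaultForms V E m q) :
    dbarB V q (mapF V E m q η) = mapF V E m (q + 1) (dbar V m q η) := by
  have : IsManifold 𝓘(ℝ, V) ∞ B := isManifold_real V B
  funext p
  have hb := mem_base p
  set fm := fiberCoord (rho p) p ^ (-m) with hfm
  set a := coeff V m q (rho p) η (rho p) with ha
  set θ := Complex.ofRealCLM ∘L theta V p with hθ
  set pr := ContinuousLinearMap.fst ℝ V ℝ with hpr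
  have hself : fiberCoord (rho p) (circleInv V p (chartAt (V × ℝ) p p)) = fiberCoord (rho p) p := by
    rw [circle_chart_self, circleInv_self]
  have hd := differentiableAt_coeff V ⟨η, hη⟩ (rho p)
  have hext : extD (mapF V E m q η) p =
      wedgeOne q ((((-m : ℤ) : ℂ) * fm) •
        (Complex.I • θ - chernForm (E := E) V (rho p) (rho p) ∘L pr))
        (a.compContinuousLinearMap pr) +
      fm • (extD (coeff V m q (rho p) η) (rho p)).compContinuousLinearMap pr := by
    have hd' : DifferentiableAt ℝ (chartRep (coeff V m q (rho p) η) (rho p))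
        (chartAt (V × ℝ) p p).1 := by
      rw [circle_chart_self]; exact hd
    have hev := Filter.eventuallyEq_of_mem ((chartAt (V × ℝ) p).open_target.mem_nhds
      (mem_chart_target (V × ℝ) p)) fun u hu => chartRep_mapF η hu
    have hpull : DifferentiableAt ℝ (fun u : V × ℝ =>
        (chartRep (coeff V m q (rho p) η) (rho p) u.1).compContinuousLinearMap pr)
        (chartAt (V × ℝ) p p) :=
      ((contDiff_compContinuousLinearMap pr (n := 1)).differentiable
        (by simp)).differentiableAt.comp _ (hd'.comp _ differentiableAt_fst)
    rw [extD, hev.extDeriv_eq, extDeriv_smul_function (hasFDerivAt_fiberCoord_zpow (-m) p) hpull,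
      extDeriv_comp_fst hd', hself, circle_chart_self,
      chartRep_self]
    rfl
  have hψ : mapF V E m q η p = fm • a.compContinuousLinearMap pr := mapF_eq_coeff η hb
  have hr : restrictVbar V p (a.compContinuousLinearMap pr) = a.compContinuousLinearMap pr := by
    rw [restrictVbar_comp_fst, ha, coeff, projZeroQ_coe]
  have hβ : beta V p = (-Complex.I) • θ := rfl
  have hL : lieT V q (mapF V E m q η) p = -(Complex.I * m) • mapF V E m q η p :=
    congrFun (lieT_eq V E ⟨_, mapF_mem_fourierForms hη⟩) p
  rw [dbarB, dVbar, hext, hL, hψ,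
    mapF_eq_coeff _ hb, coeff_dbar hη hb, ← hfm, map_add, map_smul, restrictVbar_comp_fst, hβ,
    wedgeOne_smul, wedgeOne_smul, wedgeOne_sub, wedgeOne_smul, map_smul, map_sub, map_smul,
    restrictVbar_wedgeOne_theta, restrictVbar_wedgeOne_comp_fst p (chernForm_smul_I (rho p)), hr,
    map_smul, map_smul]
  simp only [smul_smul, sub_zero]
  have hc : Complex.I * (-Complex.I * (-(Complex.I * m) * fm)) =
      ((-m : ℤ) : ℂ) * fm * Complex.I := by
    push_cast
    linear_combination Complex.I * m * fm * Complex.I_mul_I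
  rw [hc]
  exact add_sub_cancel_left _ _

end MapF

/-! ### Cohomology -/
section Cohomology
variable {X Y : ℕ → Type*} [∀ q, AddCommGroup (X q)] [∀ q, Module ℂ (X q)]
  [∀ q, AddCommGroup (Y q)] [∀ q, Module ℂ (Y q)]

/-- An isomorphism of complexes induces isomorphisms of the cohomology groups. -/
theorem exists_cohomology_equiv {A : ∀ q, Submodule ℂ (X q)} {A' : ∀ q, Submodule ℂ (Y q)}
    {d : ∀ q, A q →ₗ[ℂ] X (q + 1)} {d' : ∀ q, A' q →ₗ[ℂ] Y (q + 1)} (F : ∀ q, X q →ₗ[ℂ] Y q)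
    (hF : ∀ q, BijOn (F q) (A q) (A' q)) (hA : ∀ q a, d q a ∈ A (q + 1))
    (hd : ∀ q (a : A q) (a' : A' q), F q a = a' → d' q a' = F (q + 1) (d q a)) (q : ℕ) :
    ∃ Φ : Cohomology A d q ≃ₗ[ℂ] Cohomology A' d' q,
      ∀ (a : LinearMap.ker (d q)) (a' : LinearMap.ker (d' q)), F q a.1.1 = a'.1.1 →
        Φ (cohomologyClass A d q a) = cohomologyClass A' d' q a' := by
  have hker : ∀ (a : A q) (a' : A' q), F q a = a' → (d q a = 0 ↔ d' q a' = 0) := by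
    intro a a' h
    rw [hd q a a' h]
    refine ⟨fun h0 => by rw [h0, map_zero], fun h0 => ?_⟩
    exact (hF (q + 1)).injOn (hA q a) (A (q + 1)).zero_mem (h0.trans (map_zero _).symm)
  -- In degree `0` this says that `F 0` is injective, as there are no coboundaries.
  have hcob : ∀ (q : ℕ) (a : A q), a.1 ∈ coboundaries A d q ↔ F q a.1 ∈ coboundaries A' d' q := by
    intro q a
    cases q with
    | zero =>
      refine ⟨fun h => ?_, fun h => ?_⟩
      · have h0 : a.1 = 0 := h
        rw [h0, map_zero]; exact Submodule.zero_mem _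
      · have h0 : F 0 a.1 = 0 := h
        exact (hF 0).injOn a.2 (A 0).zero_mem (h0.trans (map_zero _).symm)
    | succ q =>
      refine ⟨?_, ?_⟩
      · rintro ⟨b, hb⟩
        exact ⟨⟨F q b, (hF q).mapsTo b.2⟩, by rw [hd q b _ rfl, hb]⟩
      · rintro ⟨b', hb'⟩
        obtain ⟨b, hb, hbb⟩ := (hF q).surjOn b'.2
        refine ⟨⟨b, hb⟩, (hF (q + 1)).injOn (hA q _) a.2 ?_⟩
        rw [← hd q ⟨b, hb⟩ b' hbb, hb']
  let K₀ : LinearMap.ker (d q) →ₗ[ℂ] LinearMap.ker (d' q) :=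
    LinearMap.codRestrict _ (LinearMap.codRestrict (A' q)
      (F q ∘ₗ (A q).subtype ∘ₗ (LinearMap.ker (d q)).subtype) fun a => (hF q).mapsTo a.1.2)
      fun a => (hker a.1 _ rfl).1 a.2
  have hK : Function.Bijective K₀ := by
    refine ⟨fun a b hab => ?_, fun a' => ?_⟩
    · exact Subtype.ext (Subtype.ext ((hF q).injOn a.1.2 b.1.2
        (congrArg (fun x : LinearMap.ker (d' q) => x.1.1) hab)))
    · obtain ⟨a, ha, haa⟩ := (hF q).surjOn a'.1.2
      exact ⟨⟨⟨a, ha⟩, (hker ⟨a, ha⟩ a'.1 haa).2 a'.2⟩, Subtype.ext (Subtype.ext haa)⟩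
  let K := LinearEquiv.ofBijective K₀ hK
  refine ⟨Submodule.Quotient.equiv _ _ K ?_, fun a a' h => ?_⟩
  · ext a'
    obtain ⟨a, rfl⟩ := K.surjective a'
    refine (Submodule.mem_map_equiv _).trans ?_
    rw [K.symm_apply_apply]
    exact hcob q a.1
  · have h' : K a = a' := Subtype.ext (Subtype.ext h)
    rw [← h']
    rfl

end Cohomology

end CircleBundleCR
end

open CircleBundleCR
theorem mainTheorem6 {V : Type*} [NormedAddCommGroup V] [NormedSpace ℂ V] [FiniteDimensional ℂ V]
    {B : Type*} [TopologicalSpace B] [ChartedSpace V B] [IsManifold 𝓘(ℂ, V) ω B]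
    (E : B → Type*) [∀ x, NormedAddCommGroup (E x)] [∀ x, InnerProductSpace ℂ (E x)]
    [TopologicalSpace (TotalSpace ℂ E)] [FiberBundle ℂ E] [VectorBundle ℂ ℂ E]
    [ContMDiffVectorBundle ω ℂ E 𝓘(ℂ, V)] [SmoothHermitian V E] (m : ℤ) :
    -- `F_m` is a linear isomorphism of `C^∞(B; Λ^{0,q} B ⊗ E^m)` onto `C^∞_m(SE; Λ^q K̄*)`
    (∀ q : ℕ, BijOn (mapF V E m q) (dolbeaultForms V E m q) (fourierForms V E m q)) ∧
    -- `∂̄` and `∂̄_b` define complexes on these spaces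
    (∀ (q : ℕ), ∀ η ∈ dolbeaultForms V E m q,
      dbar V m q η ∈ dolbeaultForms V E m (q + 1) ∧ dbar V m (q + 1) (dbar V m q η) = 0) ∧
    (∀ (q : ℕ), ∀ φ ∈ fourierForms V E m q,
      dbarB V q φ ∈ fourierForms V E m (q + 1) ∧ dbarB V (q + 1) (dbarB V q φ) = 0) ∧
    -- `∂̄_b F_m = F_m ∂̄`
    (∀ (q : ℕ), ∀ η ∈ dolbeaultForms V E m q,
      dbarB V q (mapF V E m q η) = mapF V E m (q + 1) (dbar V m q η)) ∧
    -- `F_m` induces isomorphisms of the cohomology groups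
    (∀ q : ℕ, ∃ Φ : DolbeaultCohomology V E m q ≃ₗ[ℂ] FourierCohomology V E m q,
      ∀ (η : LinearMap.ker (dbarLin V E m q)) (φ : LinearMap.ker (dbarBLin V E m q)),
        mapF V E m q η.1.1 = φ.1.1 → Φ (dolbeaultClass V E m q η) = fourierClass V E m q φ) := by
  -- Every form in `C^∞_m(SE; Λ^q K̄*)` is `F_m(η)` for some `η`, and `∂̄_b F_m = F_m ∂̄`.
  have hBB : ∀ q : ℕ, ∀ φ ∈ fourierForms V E m q,
      dbarB V q φ ∈ fourierForms V E m (q + 1) ∧ dbarB V (q + 1) (dbarB V q φ) = 0 := by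
    intro q φ hφ
    obtain ⟨η, hη, rfl⟩ := exists_mapF_eq hφ
    rw [dbarB_mapF hη]
    refine ⟨mapF_mem_fourierForms (dbar_mem_dolbeaultForms hη), ?_⟩
    rw [dbarB_mapF (dbar_mem_dolbeaultForms hη), dbar_dbar hη, map_zero]
  refine ⟨fun q => bijOn_mapF, fun q η hη => ⟨dbar_mem_dolbeaultForms hη, dbar_dbar hη⟩, hBB,
    fun q η hη => dbarB_mapF hη, ?_⟩
  refine exists_cohomology_equiv (X := BundleForm V E m) (Y := CircleForm V E)
    (mapF V E m) (fun q => bijOn_mapF) (fun q η => dbar_mem_dolbeaultForms η.2) ?_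
  intro q η φ h
  exact (congrArg (dbarB V q) h.symm).trans (dbarB_mapF η.2)
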